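/- Let $K$ be a field of characteristic zero. For $r,s\ge 0$ let $D(r,s)$ be the set of set partitions ("diagrams") of $[r]\sqcup[s]$. For $x\in D(r,s)$ and $y\in D(s,t)$ consider the equivalence relation on $[r]\sqcup[s]\sqcup[t]$ generated by $x$ and $y$; let $x\circ y\in D(r,t)$ be its restriction to $[r]\sqcup[t]$, and let $c(x,y)$ be the number of its blocks that do not meet $[r]\sqcup[t]$. For $\delta\in K$ the partition category has objects $r\in\mathbb N$, morphism spaces $KD(r,s)$ and composition $x\cdot y=\delta^{c(x,y)}\,x\circ y$ (first $x$, then $y$); the partition algebra is $D_r=KD(r,r)$. The propagating number $\mathrm{pr}(x)$ is the number of blocks of $x$ meeting both $[r]$ and $[s]$. Let $KD(p,r;p)$ be the span of the $x\in D(p,r)$ with $\mathrm{pr}(x)=p$, on which morphisms act by composition, diagrams with propagating number less than $p$ being set to zero. The diagrams in $D(p,p;p)$ are the permutation diagrams, so that $A_p=KD(p,p;p)\cong K\mathfrak S_p$, and for an $\mathfrak S_p$-module $W$, regarded as a right $A_p$-module, the inflation is the right $D_r$-module $$\mathrm{Inf}_p^r(W)=W\otimes_{A_p}KD(p,r;p).$$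 Let $n\ge 0$, put $\delta=n$, and let $V$ be the permutation representation of $\mathfrak S_n$ over $K$ with basis $v_1,\dots,v_n$. A diagram $x\in D(r,s)$ is evaluated to the $\mathfrak S_n$-equivariant map $\mathrm{ev}(x)\colon\otimes^rV\to\otimes^sV$, $$v_{i_1}\otimes\dots\otimes v_{i_r}\mapsto\sum_{j_1,\dots,j_s} x^{i}_{j}\; v_{j_1}\otimes\dots\otimes v_{j_s},$$ where $x^{i}_{j}=1$ if indices attached to vertices in the same block of $x$ are always equal, and $x^{i}_{j}=0$ otherwise. Diagrams act on the spaces $\mathrm{Hom}_{\mathfrak S_n}(S,\otimes^rV)$ by $f\cdot x=\mathrm{ev}(x)\circ f$; in particular each of these spaces is a right $D_r$-module. Theorem. Let $\mu$ be a partition of $n$, let $\tilde\mu$ be $\mu$ with its first (largest) part removed, let $p=|\tilde\mu|$, and let $S^\mu$ and $S^{\tilde\mu}$ be the corresponding Specht modules of $\mathfrak S_n$ and $\mathfrak S_p$ over $K$ (the left ideals of the group algebras generated by the Young symmetrizers of arbitrary tableaux of these shapes). Then for all $r$ with $n\ge 2r$ there are isomorphisms of $D_r$-modules $$\varphi_r\colon\mathrm{Hom}_{\mathfrak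 S_n}(S^\mu,\otimes^rV)\;\cong\;\mathrm{Inf}_p^r\big(S^{\tilde\mu}\big),$$ and they are natural in $r$: $\varphi_s(f\cdot x)=\varphi_r(f)\cdot x$ for all $r,s$ with $2r,2s\le n$, all $x\in KD(r,s)$ and all $f\in\mathrm{Hom}_{\mathfrak S_n}(S^\mu,\otimes^rV)$. -/

import Mathlib

/-- A diagram in `D(r, s)`: a set partition of the disjoint union `[r] ⊔ [s]` (`r` upper and `s`
lower vertices), given as an equivalence relation whose classes are the blocks. -/
abbrev PartitionDiagram (r s : ℕ) : Type := Setoid (Fin r ⊕ Fin s)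

namespace PartitionDiagram

variable {r s t u : ℕ}

/-- The inclusion `[r] ⊔ [s] → [r] ⊔ [s] ⊔ [t]`. -/
def upper : Fin r ⊕ Fin s → Fin r ⊕ Fin s ⊕ Fin t := Sum.map id Sum.inl

/-- The inclusion `[s] ⊔ [t] → [r] ⊔ [s] ⊔ [t]`. -/
def lower : Fin s ⊕ Fin t → Fin r ⊕ Fin s ⊕ Fin t := Sum.inr

/-- The inclusion `[r] ⊔ [t] → [r] ⊔ [s] ⊔ [t]`. -/
def outer : Fin r ⊕ Fin t → Fin r ⊕ Fin s ⊕ Fin t := Sum.map id Sum.inr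

/-- The equivalence relation on `[r] ⊔ [s] ⊔ [t]` generated by `x` and `y`: `x` is stacked on top
of `y` and the middle vertices are identified. -/
def glue (x : PartitionDiagram r s) (y : PartitionDiagram s t) :
    Setoid (Fin r ⊕ Fin s ⊕ Fin t) :=
  sInf {R | x ≤ R.comap upper ∧ y ≤ R.comap lower}

/-- The diagram `x ∘ y` (`x` on top of `y`): the blocks of `glue x y` that meet `[r] ⊔ [t]`,
restricted to `[r] ⊔ [t]`. -/
def comp (x : PartitionDiagram r s) (y : PartitionDiagram s t) : PartitionDiagram r t :=
  (glue x y).comap outer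

/-- The number `c(x, y)` of blocks of `glue x y` that contain no element of `[r] ⊔ [t]`. -/
noncomputable def loops (x : PartitionDiagram r s) (y : PartitionDiagram s t) : ℕ :=
  Nat.card {q : Quotient (glue x y) // ∀ a, Quotient.mk (glue x y) (outer a) ≠ q}

/-- The diagram of a permutation: the upper vertex `i` is joined to the lower vertex `σ i`. Hence
`ofPerm σ ∘ ofPerm τ = ofPerm (τ * σ)`, and `ofPerm 1` is the identity diagram. -/
def ofPerm (σ : Equiv.Perm (Fin r)) : PartitionDiagram r r := Setoid.ker (Sum.elim σ id)

/-- The propagating number: the number of through blocks, that is, of blocks that meet both the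
upper and the lower row. -/
noncomputable def pr (x : PartitionDiagram r s) : ℕ :=
  Nat.card {q : Quotient x // (∃ i, Quotient.mk x (Sum.inl i) = q) ∧
    ∃ j, Quotient.mk x (Sum.inr j) = q}

/-- The labellings `i` of the upper and `j` of the lower vertices take equal values on vertices in
the same block of `x`. -/
def Compat {N : ℕ} (x : PartitionDiagram r s) (i : Fin r → Fin N) (j : Fin s → Fin N) : Prop :=
  x ≤ Setoid.ker (Sum.elim i j)

theorem glue_le_iff (x : PartitionDiagram r s) (y : PartitionDiagram s t)
    (R : Setoid (Fin r ⊕ Fin s ⊕ Fin t)) :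
    glue x y ≤ R ↔ x ≤ R.comap upper ∧ y ≤ R.comap lower := by
  constructor
  · intro h
    refine ⟨fun {a b} hab => h ?_, fun {a b} hab => h ?_⟩
    · exact fun S hS => hS.1 hab
    · exact fun S hS => hS.2 hab
  · intro h
    exact sInf_le h

theorem compat_glue_iff {N : ℕ} (x : PartitionDiagram r s) (y : PartitionDiagram s t)
    (i : Fin r → Fin N) (f : Fin s → Fin N) (k : Fin t → Fin N) :
    (Compat x i f ∧ Compat y f k) ↔ glue x y ≤ Setoid.ker (Sum.elim i (Sum.elim f k)) := by
  rw [glue_le_iff]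
  refine and_congr ?_ ?_
  · unfold Compat
    have : (Setoid.ker (Sum.elim i (Sum.elim f k))).comap upper = Setoid.ker (Sum.elim i f) := by
      ext a b
      rcases a with a | a <;> rcases b with b | b <;> rfl
    rw [this]
  · rfl

theorem card_compat {N : ℕ} (x : PartitionDiagram r s) (y : PartitionDiagram s t)
    (i : Fin r → Fin N) (k : Fin t → Fin N) (h : Compat (comp x y) i k) :
    Nat.card {f : Fin s → Fin N // Compat x i f ∧ Compat y f k} = N ^ loops x y := by
  classical
  set I := {q : Quotient (glue x y) // ∀ a, Quotient.mk (glue x y) (outer a) ≠ q} with hI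
  have : Nat.card (I → Fin N) = N ^ loops x y := by
    rw [Nat.card_fun, Nat.card_eq_fintype_card (α := Fin N), Fintype.card_fin]; rfl
  rw [← this]
  refine Nat.card_congr (Equiv.ofBijective
    (fun f q => Quotient.lift (Sum.elim i (Sum.elim f.1 k))
      (fun a b hab => (compat_glue_iff x y i f.1 k).1 f.2 hab) q.1) ⟨?_, ?_⟩)
  · intro f g hfg
    apply Subtype.ext
    funext m
    by_cases hm : ∃ a, Quotient.mk (glue x y) (outer a) = Quotient.mk (glue x y) (Sum.inr (Sum.inl m))
    · obtain ⟨a, ha⟩ := hm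
      have h1 := (compat_glue_iff x y i f.1 k).1 f.2 (Quotient.exact ha)
      have h2 := (compat_glue_iff x y i g.1 k).1 g.2 (Quotient.exact ha)
      rcases a with a | a
      · exact (h1.symm.trans h2 :)
      · exact (h1.symm.trans h2 :)
    · push Not at hm
      exact congrFun hfg ⟨_, hm⟩
  · intro g
    let G : Quotient (glue x y) → Fin N := fun q =>
      if hq : ∃ a, Quotient.mk (glue x y) (outer a) = q then Sum.elim i k hq.choose
      else g ⟨q, fun a ha => hq ⟨a, ha⟩⟩
    have hout : ∀ a, G (Quotient.mk _ (outer a)) = Sum.elim i k a := by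
      intro a
      have hq : ∃ a', Quotient.mk (glue x y) (outer a') = Quotient.mk (glue x y) (outer a) := ⟨a, rfl⟩
      simp only [G, dif_pos hq]
      exact h (show (glue x y) _ _ from Quotient.exact hq.choose_spec)
    have key : Sum.elim i (Sum.elim (fun m => G (Quotient.mk _ (Sum.inr (Sum.inl m)))) k) =
        fun a => G (Quotient.mk _ a) := by
      funext a
      rcases a with a | a | a
      · exact (hout (Sum.inl a)).symm
      · rfl
      · exact (hout (Sum.inr a)).symm
    refine ⟨⟨fun m => G (Quotient.mk _ (Sum.inr (Sum.inl m))), ?_⟩, ?_⟩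
    · rw [compat_glue_iff, key]
      intro a b hab
      exact congrArg G (Quotient.sound hab)
    · funext q
      obtain ⟨q, hq⟩ := q
      induction q using Quotient.inductionOn with
      | h a =>
        have : Sum.elim i (Sum.elim (fun m => G (Quotient.mk _ (Sum.inr (Sum.inl m)))) k) a =
          G (Quotient.mk _ a) := congrFun key a
        refine this.trans ?_
        have hn : ¬ ∃ a', Quotient.mk (glue x y) (outer a') = Quotient.mk (glue x y) a := by
          rintro ⟨a', ha'⟩; exact hq a' ha'
        simp only [G, dif_neg hn]

theorem compat_comp_of {N : ℕ} (x : PartitionDiagram r s) (y : PartitionDiagram s t)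
    (i : Fin r → Fin N) (f : Fin s → Fin N) (k : Fin t → Fin N)
    (hx : Compat x i f) (hy : Compat y f k) : Compat (comp x y) i k := by
  intro a b hab
  have := (compat_glue_iff x y i f k).1 ⟨hx, hy⟩ hab
  rcases a with a | a <;> rcases b with b | b <;> exact this

open Classical in
/-- The matrix entry of `x` at the labellings `i`, `j`: one if vertices in the same block of `x`
always have the same label, and zero otherwise. -/
noncomputable def coeff {N : ℕ} (x : PartitionDiagram r s) (i : Fin r → Fin N)
    (j : Fin s → Fin N) : ℕ := if Compat x i j then 1 else 0

theorem sum_coeff_mul {N : ℕ} (x : PartitionDiagram r s) (y : PartitionDiagram s t)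
    (i : Fin r → Fin N) (k : Fin t → Fin N) :
    ∑ f, coeff x i f * coeff y f k = N ^ loops x y * coeff (comp x y) i k := by
  classical
  by_cases h : Compat (comp x y) i k
  · have := card_compat x y i k h
    rw [Nat.card_eq_fintype_card, Fintype.card_subtype] at this
    rw [show coeff (comp x y) i k = 1 from if_pos h, mul_one, ← this, Finset.card_filter]
    refine Finset.sum_congr rfl fun f _ => ?_
    simp only [coeff]
    by_cases h1 : Compat x i f <;> by_cases h2 : Compat y f k <;> simp [h1, h2]
  · rw [show coeff (comp x y) i k = 0 from if_neg h, mul_zero]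
    refine Finset.sum_eq_zero fun f _ => ?_
    simp only [coeff]
    by_cases h1 : Compat x i f <;> by_cases h2 : Compat y f k <;> simp [h1, h2]
    exact h (compat_comp_of x y i f k h1 h2)

theorem eq_of_coeff_two {x y : PartitionDiagram r s}
    (h : ∀ (i : Fin r → Fin 2) (j : Fin s → Fin 2), coeff x i j = coeff y i j) : x = y := by
  classical
  have aux : ∀ {x y : PartitionDiagram r s},
      (∀ (i : Fin r → Fin 2) (j : Fin s → Fin 2), coeff x i j = coeff y i j) → x ≤ y := by
    intro x y h a b hab
    let g : Fin r ⊕ Fin s → Fin 2 := fun c => if y a c then 1 else 0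
    have hg : Sum.elim (g ∘ Sum.inl) (g ∘ Sum.inr) = g := Sum.elim_comp_inl_inr g
    have hy : Compat y (g ∘ Sum.inl) (g ∘ Sum.inr) := by
      unfold Compat
      rw [hg]
      intro c d hcd
      have : y a c ↔ y a d := ⟨fun h => y.trans h hcd, fun h => y.trans h (y.symm hcd)⟩
      simp [Setoid.ker_def, g, this]
    have hx : Compat x (g ∘ Sum.inl) (g ∘ Sum.inr) := by
      by_contra hx
      have := h (g ∘ Sum.inl) (g ∘ Sum.inr)
      simp [coeff, hx, hy] at this
    have := hx hab
    rw [hg] at this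
    simp only [Setoid.ker_def, g] at this
    have haa : y a a := y.refl a
    by_contra hyab
    simp [hyab] at this
  exact le_antisymm (aux h) (aux fun i j => (h i j).symm)

theorem coeff_const (x : PartitionDiagram r s) {N : ℕ} (c : Fin N) :
    coeff x (fun _ => c) (fun _ => c) = 1 := by
  refine if_pos ?_
  intro a b _
  rcases a with a | a <;> rcases b with b | b <;> rfl

theorem assoc_aux {N : ℕ} (x : PartitionDiagram r s) (y : PartitionDiagram s t)
    (z : PartitionDiagram t u) (i : Fin r → Fin N) (l : Fin u → Fin N) :
    N ^ (loops x y + loops (comp x y) z) * coeff (comp (comp x y) z) i l =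
      N ^ (loops y z + loops x (comp y z)) * coeff (comp x (comp y z)) i l := by
  rw [pow_add, pow_add, mul_assoc, mul_assoc, ← sum_coeff_mul, ← sum_coeff_mul, Finset.mul_sum,
    Finset.mul_sum]
  have h1 : ∀ f : Fin t → Fin N, N ^ loops x y * (coeff (comp x y) i f * coeff z f l) =
      ∑ g, coeff x i g * coeff y g f * coeff z f l := fun f => by
    rw [← mul_assoc, ← sum_coeff_mul, Finset.sum_mul]
  have h2 : ∀ g : Fin s → Fin N, N ^ loops y z * (coeff x i g * coeff (comp y z) g l) =
      ∑ f, coeff x i g * coeff y g f * coeff z f l := fun g => by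
    rw [mul_left_comm, ← sum_coeff_mul, Finset.mul_sum]
    exact Finset.sum_congr rfl fun f _ => (mul_assoc _ _ _).symm
  rw [Finset.sum_congr rfl fun f _ => h1 f, Finset.sum_congr rfl fun g _ => h2 g, Finset.sum_comm]

theorem loops_assoc (x : PartitionDiagram r s) (y : PartitionDiagram s t)
    (z : PartitionDiagram t u) :
    loops x y + loops (comp x y) z = loops y z + loops x (comp y z) := by
  have := assoc_aux (N := 2) x y z (fun _ => 0) (fun _ => 0)
  rw [coeff_const, coeff_const, mul_one, mul_one] at this
  exact Nat.pow_right_injective le_rfl this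

theorem comp_assoc (x : PartitionDiagram r s) (y : PartitionDiagram s t)
    (z : PartitionDiagram t u) : comp (comp x y) z = comp x (comp y z) := by
  refine eq_of_coeff_two fun i j => ?_
  have := assoc_aux x y z i j
  rw [loops_assoc] at this
  exact Nat.eq_of_mul_eq_mul_left (by positivity) this

theorem compat_ofPerm {N : ℕ} (σ : Equiv.Perm (Fin r)) (i j : Fin r → Fin N) :
    Compat (ofPerm σ) i j ↔ i = j ∘ σ := by
  constructor
  · intro h
    funext a
    exact h (show (ofPerm σ) (Sum.inl a) (Sum.inr (σ a)) from rfl)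
  · rintro rfl
    intro a b hab
    rcases a with a | a <;> rcases b with b | b <;>
      simpa using congrArg j (show _ = _ from hab)

theorem sum_coeff_ofPerm_mul {N : ℕ} (σ : Equiv.Perm (Fin r)) (y : PartitionDiagram r s)
    (i : Fin r → Fin N) (k : Fin s → Fin N) :
    ∑ f, coeff (ofPerm σ) i f * coeff y f k = coeff y (i ∘ σ.symm) k := by
  classical
  rw [Finset.sum_eq_single (i ∘ σ.symm)]
  · rw [coeff, if_pos ((compat_ofPerm _ _ _).2 (by funext a; simp)), one_mul]
  · intro f _ hf
    rw [coeff, if_neg, zero_mul]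
    intro h
    apply hf
    rw [(compat_ofPerm _ _ _).1 h]
    funext a; simp
  · simp

theorem sum_coeff_mul_ofPerm {N : ℕ} (σ : Equiv.Perm (Fin s)) (x : PartitionDiagram r s)
    (i : Fin r → Fin N) (k : Fin s → Fin N) :
    ∑ f, coeff x i f * coeff (ofPerm σ) f k = coeff x i (k ∘ σ) := by
  classical
  rw [Finset.sum_eq_single (k ∘ σ)]
  · rw [coeff, coeff, if_pos ((compat_ofPerm _ _ _).2 rfl), mul_one]
  · intro f _ hf
    rw [coeff, coeff, if_neg (c := Compat (ofPerm σ) f k), mul_zero]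
    exact fun h => hf ((compat_ofPerm _ _ _).1 h)
  · simp

theorem loops_ofPerm_left (σ : Equiv.Perm (Fin r)) (y : PartitionDiagram r s) :
    loops (ofPerm σ) y = 0 := by
  have := sum_coeff_mul (ofPerm σ) y (fun _ => (0 : Fin 2)) (fun _ => 0)
  rw [sum_coeff_ofPerm_mul, coeff_const, mul_one] at this
  have h : coeff y ((fun _ => (0 : Fin 2)) ∘ σ.symm) (fun _ => 0) = 1 := coeff_const y 0
  rw [h] at this
  by_contra hne
  have := Nat.one_lt_two_pow hne
  omega

theorem loops_ofPerm_right (x : PartitionDiagram r s) (σ : Equiv.Perm (Fin s)) :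
    loops x (ofPerm σ) = 0 := by
  have := sum_coeff_mul x (ofPerm σ) (fun _ => (0 : Fin 2)) (fun _ => 0)
  rw [sum_coeff_mul_ofPerm, coeff_const, mul_one] at this
  have h : coeff x (fun _ => (0 : Fin 2)) ((fun _ => 0) ∘ σ) = 1 := coeff_const x 0
  rw [h] at this
  by_contra hne
  have := Nat.one_lt_two_pow hne
  omega

theorem one_comp (y : PartitionDiagram r s) : comp (ofPerm 1) y = y := by
  refine eq_of_coeff_two fun i k => ?_
  have := sum_coeff_mul (ofPerm 1) y i k
  rw [sum_coeff_ofPerm_mul, loops_ofPerm_left, pow_zero, one_mul] at this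
  exact this.symm

theorem comp_one (x : PartitionDiagram r s) : comp x (ofPerm 1) = x := by
  refine eq_of_coeff_two fun i k => ?_
  have := sum_coeff_mul x (ofPerm 1) i k
  rw [sum_coeff_mul_ofPerm, loops_ofPerm_right, pow_zero, one_mul] at this
  exact this.symm

theorem pr_comp_le_left (x : PartitionDiagram r s) (y : PartitionDiagram s t) :
    pr (comp x y) ≤ pr x := by
  classical
  -- an `x`-block of a top vertex in a propagating block of `x ∘ y` is propagating
  have key : ∀ (i : Fin r) (k : Fin t), (comp x y) (Sum.inl i) (Sum.inr k) →
      ∃ j : Fin s, x (Sum.inl i) (Sum.inr j) := by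
    intro i k hik
    by_contra hne
    push Not at hne
    let R : Setoid (Fin r ⊕ Fin s ⊕ Fin t) := Setoid.ker
      (Sum.elim (fun a => x (Sum.inl i) (Sum.inl a)) (fun _ => False))
    have hR : glue x y ≤ R := by
      rw [glue_le_iff]
      constructor
      · intro a b hab
        have e : x (Sum.inl i) a ↔ x (Sum.inl i) b :=
          ⟨fun h => x.trans h hab, fun h => x.trans h (x.symm hab)⟩
        rcases a with a | a <;> rcases b with b | b <;>
          simp [R, Setoid.ker_def, upper, hne] at e ⊢ <;> tauto
      · intro a b hab
        rfl
    have := hR hik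
    simp [R, outer, Setoid.ker_def] at this
  refine Nat.card_le_card_of_injective (fun q =>
    ⟨Quotient.mk x (Sum.inl q.2.1.choose), ⟨_, rfl⟩, ?_⟩) ?_
  · obtain ⟨j, hj⟩ := q.2.2
    obtain ⟨m, hm⟩ := key q.2.1.choose j (Quotient.exact (q.2.1.choose_spec.trans hj.symm))
    exact ⟨m, Quotient.sound (x.symm hm)⟩
  · intro q q' h
    have hx : x (Sum.inl q.2.1.choose) (Sum.inl q'.2.1.choose) :=
      Quotient.exact (congrArg Subtype.val h)
    have hg := ((glue_le_iff x y _).1 le_rfl).1 hx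
    apply Subtype.ext
    rw [← q.2.1.choose_spec, ← q'.2.1.choose_spec]
    exact Quotient.sound hg

theorem pr_comp_le_right (x : PartitionDiagram r s) (y : PartitionDiagram s t) :
    pr (comp x y) ≤ pr y := by
  classical
  have key : ∀ (i : Fin t) (k : Fin r), (comp x y) (Sum.inr i) (Sum.inl k) →
      ∃ j : Fin s, y (Sum.inr i) (Sum.inl j) := by
    intro i k hik
    by_contra hne
    push Not at hne
    let R : Setoid (Fin r ⊕ Fin s ⊕ Fin t) := Setoid.ker
      (Sum.elim (fun _ => False) (Sum.elim (fun _ => False) (fun a => y (Sum.inr i) (Sum.inr a))))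
    have hR : glue x y ≤ R := by
      rw [glue_le_iff]
      constructor
      · intro a b hab
        rcases a with a | a <;> rcases b with b | b <;> rfl
      · intro a b hab
        have e : y (Sum.inr i) a ↔ y (Sum.inr i) b :=
          ⟨fun h => y.trans h hab, fun h => y.trans h (y.symm hab)⟩
        rcases a with a | a <;> rcases b with b | b <;>
          simp [R, Setoid.ker_def, lower, hne] at e ⊢ <;> tauto
    have := hR hik
    simp [R, outer, Setoid.ker_def] at this
  refine Nat.card_le_card_of_injective (fun q =>
    ⟨Quotient.mk y (Sum.inr q.2.2.choose), ?_, ⟨_, rfl⟩⟩) ?_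
  · obtain ⟨j, hj⟩ := q.2.1
    obtain ⟨m, hm⟩ := key q.2.2.choose j (Quotient.exact (q.2.2.choose_spec.trans hj.symm))
    exact ⟨m, Quotient.sound (y.symm hm)⟩
  · intro q q' h
    have hx : y (Sum.inr q.2.2.choose) (Sum.inr q'.2.2.choose) :=
      Quotient.exact (congrArg Subtype.val h)
    have hg := ((glue_le_iff x y _).1 le_rfl).2 hx
    apply Subtype.ext
    rw [← q.2.2.choose_spec, ← q'.2.2.choose_spec]
    exact Quotient.sound hg

end PartitionDiagram

open scoped TensorProduct

/-- The space of morphisms `r → s` of the partition category with parameter `δ`: the free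
`K`-module on the diagrams `D(r, s)`. -/
def PartitionHom (K : Type*) [CommRing K] (_δ : K) (r s : ℕ) : Type _ :=
  PartitionDiagram r s →₀ K

namespace PartitionHom

variable {K : Type*} [CommRing K] {δ : K} {p q r s t u : ℕ}

noncomputable instance instAddCommGroup : AddCommGroup (PartitionHom K δ r s) :=
  inferInstanceAs (AddCommGroup (PartitionDiagram r s →₀ K))

noncomputable instance instModule : Module K (PartitionHom K δ r s) :=
  inferInstanceAs (Module K (PartitionDiagram r s →₀ K))

/-- A diagram as a basis vector of the morphism space. -/
noncomputable def of (x : PartitionDiagram r s) : PartitionHom K δ r s := Finsupp.single x 1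

/-- The linear map on a morphism space with prescribed values on the diagrams. -/
noncomputable def lift {M : Type*} [AddCommGroup M] [Module K M] (f : PartitionDiagram r s → M) :
    PartitionHom K δ r s →ₗ[K] M :=
  Finsupp.linearCombination K f

@[simp]
theorem lift_of {M : Type*} [AddCommGroup M] [Module K M] (f : PartitionDiagram r s → M)
    (x : PartitionDiagram r s) : lift (δ := δ) f (of x) = f x := by
  unfold lift of
  exact (Finsupp.linearCombination_single K 1 x).trans (one_smul _ _)

theorem hom_ext {M : Type*} [AddCommGroup M] [Module K M] {f g : PartitionHom K δ r s →ₗ[K] M}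
    (h : ∀ x, f (of x) = g (of x)) : f = g :=
  Finsupp.lhom_ext' fun x => LinearMap.ext_ring (h x)

/-- Composition `x · y = δ ^ c(x, y) • (x ∘ y)` in the partition category, extended bilinearly
(`x` comes first, then `y`). -/
noncomputable def mul :
    PartitionHom K δ r s →ₗ[K] PartitionHom K δ s t →ₗ[K] PartitionHom K δ r t :=
  lift fun x => lift fun y => δ ^ x.loops y • of (x.comp y)

@[simp]
theorem mul_of (x : PartitionDiagram r s) (y : PartitionDiagram s t) :
    mul (of x : PartitionHom K δ r s) (of y) = δ ^ x.loops y • of (x.comp y) := by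
  simp [mul]

theorem mul_assoc' (a : PartitionHom K δ r s) (b : PartitionHom K δ s t)
    (c : PartitionHom K δ t u) : mul (mul a b) c = mul a (mul b c) := by
  let L : PartitionHom K δ r s →ₗ[K] PartitionHom K δ s t →ₗ[K] PartitionHom K δ t u →ₗ[K]
      PartitionHom K δ r u := mul.compr₂ mul
  let R : PartitionHom K δ r s →ₗ[K] PartitionHom K δ s t →ₗ[K] PartitionHom K δ t u →ₗ[K]
      PartitionHom K δ r u :=
    (LinearMap.llcomp K (PartitionHom K δ t u) (PartitionHom K δ s u) (PartitionHom K δ r u)).flip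
      |>.compl₁₂ mul mul |>.flip
  have h : L = R := by
    refine hom_ext fun x => hom_ext fun y => hom_ext fun z => ?_
    simp [L, R, smul_smul, ← pow_add, PartitionDiagram.comp_assoc, PartitionDiagram.loops_assoc]
  exact congr($h a b c)

theorem one_mul' (a : PartitionHom K δ r s) : mul (of (PartitionDiagram.ofPerm 1)) a = a := by
  have h : mul (of (PartitionDiagram.ofPerm 1) : PartitionHom K δ r r) =
      (LinearMap.id : PartitionHom K δ r s →ₗ[K] _) :=
    hom_ext fun x => by simp [PartitionDiagram.loops_ofPerm_left, PartitionDiagram.one_comp]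
  exact congr($h a)

theorem mul_one' (a : PartitionHom K δ r s) : mul a (of (PartitionDiagram.ofPerm 1)) = a := by
  have h : mul.flip (of (PartitionDiagram.ofPerm 1) : PartitionHom K δ s s) =
      (LinearMap.id : PartitionHom K δ r s →ₗ[K] _) :=
    hom_ext fun x => by simp [PartitionDiagram.loops_ofPerm_right, PartitionDiagram.comp_one]
  exact congr($h a)

/-- The partition algebra `D_r`: the endomorphism algebra of the object `r`. -/
noncomputable instance instRing : Ring (PartitionHom K δ r r) where
  __ := (instAddCommGroup : AddCommGroup (PartitionHom K δ r r))
  mul a b := mul a b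
  one := of (PartitionDiagram.ofPerm 1)
  mul_assoc := mul_assoc'
  one_mul := one_mul'
  mul_one := mul_one'
  left_distrib a b c := map_add (mul a) b c
  right_distrib a b c := mul.map_add₂ a b c
  zero_mul a := mul.map_zero₂ a
  mul_zero a := map_zero (mul a)

noncomputable instance instAlgebra : Algebra K (PartitionHom K δ r r) :=
  Algebra.ofModule (fun c a b => mul.map_smul₂ c a b) (fun c a b => map_smul (mul a) c b)

end PartitionHom

/-- The partition algebra `D_r` with parameter `δ`. -/
abbrev PartitionAlgebra (K : Type*) [CommRing K] (δ : K) (r : ℕ) : Type _ := PartitionHom K δ r r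

namespace PartitionDiagram

variable {r s : ℕ}

theorem pr_le_left (x : PartitionDiagram r s) : pr x ≤ r := by
  have := Nat.card_le_card_of_injective (fun q : {q : Quotient x // (∃ i, Quotient.mk x (Sum.inl i) = q) ∧
    ∃ j, Quotient.mk x (Sum.inr j) = q} => q.2.1.choose) (fun q q' h => Subtype.ext
      (q.2.1.choose_spec.symm.trans ((congrArg (fun i => Quotient.mk x (Sum.inl i)) h).trans
        q'.2.1.choose_spec)))
  rwa [Nat.card_eq_fintype_card (α := Fin r), Fintype.card_fin] at this

end PartitionDiagram

/-- The space `K D(p, r; p)` spanned by the diagrams in `D(p, r)` with propagating number `p`. It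
is the morphism space `p → r` of the partition category modulo the ideal spanned by the diagrams
with propagating number less than `p`. -/
def PropagatingHom (K : Type*) [CommRing K] (_δ : K) (p r : ℕ) : Type _ :=
  {x : PartitionDiagram p r // x.pr = p} →₀ K

namespace PropagatingHom

open PartitionHom

variable {K : Type*} [CommRing K] {δ : K} {p q r s t u : ℕ}

noncomputable instance instAddCommGroup : AddCommGroup (PropagatingHom K δ p r) :=
  inferInstanceAs (AddCommGroup ({x : PartitionDiagram p r // x.pr = p} →₀ K))

noncomputable instance instModule : Module K (PropagatingHom K δ p r) :=
  inferInstanceAs (Module K ({x : PartitionDiagram p r // x.pr = p} →₀ K))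

/-- A diagram with propagating number `p` as a basis vector. -/
noncomputable def of (x : PartitionDiagram p r) (h : x.pr = p) : PropagatingHom K δ p r :=
  Finsupp.single ⟨x, h⟩ 1

/-- The inclusion `K D(p, r; p) → K D(p, r)`. -/
noncomputable def incl : PropagatingHom K δ p r →ₗ[K] PartitionHom K δ p r :=
  Finsupp.linearCombination K fun x => (PartitionHom.of x.1 : PartitionHom K δ p r)

theorem incl_of (x : PartitionDiagram p r) (h : x.pr = p) :
    incl (of x h : PropagatingHom K δ p r) = PartitionHom.of x := by
  unfold incl of
  exact (Finsupp.linearCombination_single K 1 _).trans (one_smul _ _)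

theorem hom_ext {M : Type*} [AddCommGroup M] [Module K M] {f g : PropagatingHom K δ p r →ₗ[K] M}
    (h : ∀ x hx, f (of x hx) = g (of x hx)) : f = g :=
  Finsupp.lhom_ext' fun x => LinearMap.ext_ring (h x.1 x.2)

/-- The quotient map `K D(p, r) → K D(p, r; p)`: diagrams with propagating number less than `p` are
sent to zero. -/
noncomputable def proj : PartitionHom K δ p r →ₗ[K] PropagatingHom K δ p r :=
  PartitionHom.lift fun x => if h : x.pr = p then of x h else 0

theorem proj_of_eq {x : PartitionDiagram p r} (h : x.pr = p) :
    proj (PartitionHom.of x : PartitionHom K δ p r) = of x h := by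
  rw [proj, lift_of, dif_pos h]

theorem proj_of_ne {x : PartitionDiagram p r} (h : x.pr ≠ p) :
    proj (PartitionHom.of x : PartitionHom K δ p r) = 0 := by
  rw [proj, lift_of, dif_neg h]

theorem incl_proj_of (x : PartitionDiagram p r) :
    incl (proj (PartitionHom.of x : PartitionHom K δ p r)) =
      if x.pr = p then PartitionHom.of x else 0 := by
  split_ifs with h
  · rw [proj_of_eq h, incl_of]
  · rw [proj_of_ne h, map_zero]

theorem proj_incl (m : PropagatingHom K δ p r) : proj (incl m) = m := by
  have h : proj ∘ₗ incl = (LinearMap.id : PropagatingHom K δ p r →ₗ[K] _) :=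
    hom_ext fun x hx => by
      rw [LinearMap.comp_apply, incl_of, proj_of_eq hx, LinearMap.id_apply]
  exact congr($h m)

theorem proj_mul_incl_proj_left (z : PartitionHom K δ p r) (y : PartitionHom K δ r s) :
    proj (mul (incl (proj z)) y) = proj (mul z y) := by
  have h : (mul ∘ₗ incl ∘ₗ proj).compr₂ proj =
      (mul : PartitionHom K δ p r →ₗ[K] PartitionHom K δ r s →ₗ[K] _).compr₂ proj := by
    refine PartitionHom.hom_ext fun x => PartitionHom.hom_ext fun y => ?_
    simp only [LinearMap.compr₂_apply, LinearMap.comp_apply, incl_proj_of]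
    split_ifs with hx
    · rfl
    · have h1 := x.pr_comp_le_left y
      have h2 := x.pr_le_left
      rw [mul_of, map_smul, proj_of_ne (by omega)]
      simp
  exact congr($h z y)

theorem proj_mul_incl_proj_right (z : PartitionHom K δ p p) (y : PartitionHom K δ p r) :
    proj (mul z (incl (proj y))) = proj (mul z y) := by
  have h : (mul.compl₂ (incl ∘ₗ proj)).compr₂ proj =
      (mul : PartitionHom K δ p p →ₗ[K] PartitionHom K δ p r →ₗ[K] _).compr₂ proj := by
    refine PartitionHom.hom_ext fun x => PartitionHom.hom_ext fun y => ?_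
    simp only [LinearMap.compr₂_apply, LinearMap.compl₂_apply, LinearMap.comp_apply, incl_proj_of]
    split_ifs with hx
    · rfl
    · have h1 := x.pr_comp_le_right y
      have h2 := y.pr_le_left
      rw [mul_of, map_smul, proj_of_ne (by omega)]
      simp
  exact congr($h z y)

/-- The right action of the partition category on `K D(p, r; p)`: composition, where diagrams with
propagating number less than `p` are set to zero. -/
noncomputable def mulRight :
    PropagatingHom K δ p r →ₗ[K] PartitionHom K δ r s →ₗ[K] PropagatingHom K δ p s :=
  (mul ∘ₗ incl).compr₂ proj

/-- The left action on `K D(p, r; p)` of the diagram of a permutation `σ` of `[p]`. These diagrams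
are the elements of `D(p, p; p)`, so they span the algebra `A_p = K D(p, p; p) ≅ K 𝔖_p`. -/
noncomputable def permLeft (σ : Equiv.Perm (Fin p)) :
    PropagatingHom K δ p r →ₗ[K] PropagatingHom K δ p r :=
  proj ∘ₗ mul (PartitionHom.of (PartitionDiagram.ofPerm σ)) ∘ₗ incl

theorem mulRight_mulRight (m : PropagatingHom K δ p r) (y : PartitionHom K δ r s)
    (z : PartitionHom K δ s t) : mulRight (mulRight m y) z = mulRight m (mul y z) := by
  simp only [mulRight, LinearMap.compr₂_apply, LinearMap.comp_apply]
  rw [proj_mul_incl_proj_left, mul_assoc']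

theorem mulRight_one (m : PropagatingHom K δ p r) :
    mulRight m (1 : PartitionHom K δ r r) = m := by
  simp only [mulRight, LinearMap.compr₂_apply, LinearMap.comp_apply]
  have h : mul (incl m) (PartitionHom.of (PartitionDiagram.ofPerm 1)) = incl m := mul_one' _
  exact (congrArg proj h).trans (proj_incl m)

theorem mulRight_permLeft (σ : Equiv.Perm (Fin p)) (m : PropagatingHom K δ p r)
    (y : PartitionHom K δ r s) : mulRight (permLeft σ m) y = permLeft σ (mulRight m y) := by
  simp only [mulRight, permLeft, LinearMap.compr₂_apply, LinearMap.comp_apply]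
  rw [proj_mul_incl_proj_left, proj_mul_incl_proj_right, mul_assoc']

end PropagatingHom

section Inflation

variable {K : Type*} [CommRing K] {p r s t : ℕ} {W : Type*} [AddCommGroup W] [Module K W]

/-- The relations `(w · a) ⊗ m = w ⊗ (a · m)`, `a ∈ A_p`, that define the tensor product over `A_p`.
Since `ofPerm σ · ofPerm τ = ofPerm (τ * σ)`, a representation `ρ` of `𝔖_p` is the same as a right
`A_p`-module, with `w · ofPerm σ = ρ σ w`. -/
noncomputable def inflationRelations (δ : K) (ρ : Representation K (Equiv.Perm (Fin p)) W) (r : ℕ) :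
    Submodule K (W ⊗[K] PropagatingHom K δ p r) :=
  Submodule.span K {v | ∃ (σ : Equiv.Perm (Fin p)) (w : W) (m : PropagatingHom K δ p r),
    v = ρ σ w ⊗ₜ[K] m - w ⊗ₜ[K] PropagatingHom.permLeft σ m}

/-- The inflation `Inf_p^r W = W ⊗_{A_p} K D(p, r; p)` of a representation of `𝔖_p`. -/
def Inflation (δ : K) (ρ : Representation K (Equiv.Perm (Fin p)) W) (r : ℕ) : Type _ :=
  (W ⊗[K] PropagatingHom K δ p r) ⧸ inflationRelations δ ρ r

namespace Inflation

variable {δ : K} {ρ : Representation K (Equiv.Perm (Fin p)) W}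

noncomputable instance instAddCommGroup : AddCommGroup (Inflation δ ρ r) :=
  inferInstanceAs (AddCommGroup ((W ⊗[K] PropagatingHom K δ p r) ⧸ inflationRelations δ ρ r))

noncomputable instance instModuleBase : Module K (Inflation δ ρ r) :=
  inferInstanceAs (Module K ((W ⊗[K] PropagatingHom K δ p r) ⧸ inflationRelations δ ρ r))

/-- The class of the pure tensor `w ⊗ m`. -/
noncomputable def tmul (w : W) (m : PropagatingHom K δ p r) : Inflation δ ρ r :=
  Submodule.Quotient.mk (w ⊗ₜ[K] m)

theorem tmul_add (w : W) (m m' : PropagatingHom K δ p r) :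
    (tmul w (m + m') : Inflation δ ρ r) = tmul w m + tmul w m' :=
  congrArg (Submodule.mkQ (inflationRelations δ ρ r)) (TensorProduct.tmul_add w m m')

theorem tmul_smul (c : K) (w : W) (m : PropagatingHom K δ p r) :
    (tmul w (c • m) : Inflation δ ρ r) = c • tmul w m :=
  congrArg (Submodule.mkQ (inflationRelations δ ρ r)) (TensorProduct.tmul_smul c w m)

theorem hom_ext {M : Type*} [AddCommGroup M] [Module K M] {f g : Inflation δ ρ r →ₗ[K] M}
    (h : ∀ w m, f (tmul w m) = g (tmul w m)) : f = g :=
  Submodule.linearMap_qext _ (TensorProduct.ext' h)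

theorem inflationRelations_le (y : PartitionHom K δ r s) :
    inflationRelations δ ρ r ≤ (inflationRelations δ ρ s).comap
      (LinearMap.lTensor W (PropagatingHom.mulRight.flip y)) := by
  refine Submodule.span_le.2 ?_
  rintro _ ⟨σ, w, m, rfl⟩
  refine Submodule.subset_span ⟨σ, w, PropagatingHom.mulRight m y, ?_⟩
  simp [PropagatingHom.mulRight_permLeft]

/-- The right action of the partition category, `(w ⊗ m) · y = w ⊗ (m · y)`. -/
noncomputable def act : PartitionHom K δ r s →ₗ[K] Inflation δ ρ r →ₗ[K] Inflation δ ρ s where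
  toFun y := Submodule.mapQ (inflationRelations δ ρ r) (inflationRelations δ ρ s)
    (LinearMap.lTensor W (PropagatingHom.mulRight.flip y)) (inflationRelations_le y)
  map_add' y z := hom_ext fun w m => by
    change tmul w (PropagatingHom.mulRight m (y + z)) =
      (tmul w (PropagatingHom.mulRight m y) + tmul w (PropagatingHom.mulRight m z) :
        Inflation δ ρ s)
    rw [map_add, tmul_add]
  map_smul' c y := hom_ext fun w m => by
    change tmul w (PropagatingHom.mulRight m (c • y)) =
      (c • tmul w (PropagatingHom.mulRight m y) : Inflation δ ρ s)
    rw [map_smul, tmul_smul]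

@[simp]
theorem act_tmul (y : PartitionHom K δ r s) (w : W) (m : PropagatingHom K δ p r) :
    act y (tmul w m : Inflation δ ρ r) = tmul w (PropagatingHom.mulRight m y) := rfl

theorem act_mul (y : PartitionHom K δ r s) (z : PartitionHom K δ s t) (v : Inflation δ ρ r) :
    act (PartitionHom.mul y z) v = act z (act y v) := by
  have h : act (PartitionHom.mul y z) =
      (act z ∘ₗ act y : Inflation δ ρ r →ₗ[K] Inflation δ ρ t) :=
    hom_ext fun w m => by simp [PropagatingHom.mulRight_mulRight]
  exact congr($h v)

/-- `Inf_p^r W` is a right module over the partition algebra `D_r`. -/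
noncomputable instance instModule : Module (PartitionAlgebra K δ r)ᵐᵒᵖ (Inflation δ ρ r) where
  smul x v := act x.unop v
  one_smul v := by
    have h : act 1 = (LinearMap.id : Inflation δ ρ r →ₗ[K] _) :=
      hom_ext fun w m => by simp [PropagatingHom.mulRight_one]
    exact congr($h v)
  mul_smul x y v := act_mul y.unop x.unop v
  smul_zero x := map_zero (act x.unop)
  smul_add x := map_add (act x.unop)
  add_smul x y v := act.map_add₂ x.unop y.unop v
  zero_smul v := act.map_zero₂ v

end Inflation

end Inflation

section TensorPowers

variable (K : Type*) [CommRing K] (n : ℕ)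

/-- The `r`-th tensor power of the permutation module `V = K^n`. -/
abbrev tensorSpace (r : ℕ) : Type _ := PiTensorProduct K fun _ : Fin r => (Fin n →₀ K)

/-- The basis `v_{i_1} ⊗ ⋯ ⊗ v_{i_r}` of the tensor power. -/
noncomputable def tensorBasis (r : ℕ) :
    Module.Basis (Fin r → Fin n) K (tensorSpace K n r) :=
  Basis.piTensorProduct fun _ => Finsupp.basisSingleOne

/-- The permutation representation `V` of `𝔖_n`, `σ v_i = v_{σ i}`. -/
noncomputable def permRep : Representation K (Equiv.Perm (Fin n)) (Fin n →₀ K) where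
  toFun g := Finsupp.lmapDomain K K g
  map_one' := by ext; simp
  map_mul' g h := by ext; simp

/-- The diagonal action of `𝔖_n` on the `r`-th tensor power of `V`. -/
noncomputable def tensorRep (r : ℕ) :
    Representation K (Equiv.Perm (Fin n)) (tensorSpace K n r) where
  toFun g := PiTensorProduct.map fun _ => permRep K n g
  map_one' := by simp [Module.End.one_eq_id]
  map_mul' g h := by simp [Module.End.mul_eq_comp, PiTensorProduct.map_comp]

variable {K n} {r s t : ℕ}

theorem tensorBasis_apply (i : Fin r → Fin n) :
    tensorBasis K n r i = PiTensorProduct.tprod K fun k => Finsupp.single (i k) (1 : K) := by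
  simp [tensorBasis]

theorem tensorRep_basis (g : Equiv.Perm (Fin n)) (i : Fin r → Fin n) :
    tensorRep K n r g (tensorBasis K n r i) = tensorBasis K n r (g ∘ i) := by
  rw [tensorBasis_apply, tensorBasis_apply]
  exact (PiTensorProduct.map_tprod _ _).trans (by simp [permRep])

/-- The evaluation of a diagram as a linear map between tensor powers of `V`. -/
noncomputable def evalDiagram (K : Type*) [CommRing K] (n : ℕ) (x : PartitionDiagram r s) :
    tensorSpace K n r →ₗ[K] tensorSpace K n s :=
  (tensorBasis K n r).constr K fun i => ∑ j, (x.coeff i j : K) • tensorBasis K n s j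

theorem evalDiagram_basis (x : PartitionDiagram r s) (i : Fin r → Fin n) :
    evalDiagram K n x (tensorBasis K n r i) = ∑ j, (x.coeff i j : K) • tensorBasis K n s j := by
  simp [evalDiagram]

theorem PartitionDiagram.coeff_perm (x : PartitionDiagram r s) (g : Equiv.Perm (Fin n))
    (i : Fin r → Fin n) (j : Fin s → Fin n) : x.coeff (g ∘ i) (g ∘ j) = x.coeff i j := by
  have : x.Compat (g ∘ i) (g ∘ j) ↔ x.Compat i j := by
    have h : Setoid.ker (Sum.elim (g ∘ i) (g ∘ j)) = Setoid.ker (Sum.elim i j) := by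
      ext a b
      rw [← Sum.comp_elim]
      exact g.injective.eq_iff
    rw [PartitionDiagram.Compat, h, PartitionDiagram.Compat]
  classical
  unfold PartitionDiagram.coeff
  by_cases h : x.Compat i j
  · rw [if_pos h, if_pos (this.2 h)]
  · rw [if_neg h, if_neg (mt this.1 h)]

theorem evalDiagram_tensorRep (x : PartitionDiagram r s) (g : Equiv.Perm (Fin n))
    (v : tensorSpace K n r) :
    evalDiagram K n x (tensorRep K n r g v) = tensorRep K n s g (evalDiagram K n x v) := by
  have h : evalDiagram K n x ∘ₗ tensorRep K n r g = tensorRep K n s g ∘ₗ evalDiagram K n x := by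
    refine (tensorBasis K n r).ext fun i => ?_
    simp only [LinearMap.comp_apply, tensorRep_basis, evalDiagram_basis, map_sum, map_smul]
    rw [← Equiv.sum_comp (Equiv.arrowCongr (Equiv.refl (Fin s)) g)]
    refine Finset.sum_congr rfl fun j _ => ?_
    have hj : Equiv.arrowCongr (Equiv.refl (Fin s)) g j = g ∘ j := rfl
    rw [hj, PartitionDiagram.coeff_perm]
  exact congr($h v)

theorem evalDiagram_comp (x : PartitionDiagram r s) (y : PartitionDiagram s t) :
    evalDiagram K n y ∘ₗ evalDiagram K n x =
      ((n : K) ^ x.loops y) • evalDiagram K n (x.comp y) := by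
  refine (tensorBasis K n r).ext fun i => ?_
  simp only [LinearMap.comp_apply, LinearMap.smul_apply, evalDiagram_basis, map_sum, map_smul,
    Finset.smul_sum, smul_smul]
  rw [Finset.sum_comm]
  refine Finset.sum_congr rfl fun k _ => ?_
  rw [← Finset.sum_smul]
  congr 1
  have := x.sum_coeff_mul y i k
  exact_mod_cast congrArg (Nat.cast : ℕ → K) this

theorem evalDiagram_one (v : tensorSpace K n r) :
    evalDiagram K n (PartitionDiagram.ofPerm 1) v = v := by
  have h : evalDiagram K n (PartitionDiagram.ofPerm (1 : Equiv.Perm (Fin r))) = LinearMap.id := by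
    refine (tensorBasis K n r).ext fun i => ?_
    rw [evalDiagram_basis, Finset.sum_eq_single i]
    · simp [PartitionDiagram.coeff, PartitionDiagram.compat_ofPerm]
    · intro j _ hj
      simp [PartitionDiagram.coeff, PartitionDiagram.compat_ofPerm, hj.symm]
    · simp
  exact congr($h v)

end TensorPowers

section Multiplicity

variable {K : Type*} [CommRing K] {n r s t : ℕ} {W : Type*} [AddCommGroup W] [Module K W]

/-- `Hom_{𝔖_n}(W, ⊗^r V)`. -/
def TensorHom (ρ : Representation K (Equiv.Perm (Fin n)) W) (r : ℕ) : Type _ :=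
  ρ.IntertwiningMap (tensorRep K n r)

namespace TensorHom

variable {ρ : Representation K (Equiv.Perm (Fin n)) W}

noncomputable instance instAddCommMonoid : AddCommMonoid (TensorHom ρ r) :=
  inferInstanceAs (AddCommMonoid (ρ.IntertwiningMap (tensorRep K n r)))

noncomputable instance instModuleBase : Module K (TensorHom ρ r) :=
  inferInstanceAs (Module K (ρ.IntertwiningMap (tensorRep K n r)))

noncomputable instance instAddCommGroup : AddCommGroup (TensorHom ρ r) :=
  Module.addCommMonoidToAddCommGroup K

/-- The evaluation of a diagram as a map of representations of `𝔖_n`. -/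
noncomputable def evalIntertwining (x : PartitionDiagram r s) :
    (tensorRep K n r).IntertwiningMap (tensorRep K n s) where
  toLinearMap := evalDiagram K n x
  isIntertwining' g := LinearMap.ext fun v => evalDiagram_tensorRep x g v

/-- A diagram `x ∈ D(r, s)` acts on `Hom_{𝔖_n}(W, ⊗^r V)` by composition with its evaluation. -/
noncomputable def actDiagram (x : PartitionDiagram r s) : TensorHom ρ r →ₗ[K] TensorHom ρ s where
  toFun f := (evalIntertwining x).comp f
  map_add' f g := Representation.IntertwiningMap.ext <| LinearMap.ext fun w =>
    map_add (evalDiagram K n x) (f.toLinearMap w) (g.toLinearMap w)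
  map_smul' c f := Representation.IntertwiningMap.ext <| LinearMap.ext fun w =>
    map_smul (evalDiagram K n x) c (f.toLinearMap w)

/-- The right action of the partition category with parameter `δ = n` on the spaces
`Hom_{𝔖_n}(W, ⊗^r V)`. -/
noncomputable def act : PartitionHom K (n : K) r s →ₗ[K] TensorHom ρ r →ₗ[K] TensorHom ρ s :=
  PartitionHom.lift actDiagram

theorem act_mul (x : PartitionHom K (n : K) r s) (y : PartitionHom K (n : K) s t)
    (f : TensorHom ρ r) : act (PartitionHom.mul x y) f = act y (act x f) := by
  have h : PartitionHom.mul.compr₂ act =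
      ((LinearMap.llcomp K (TensorHom ρ r) (TensorHom ρ s) (TensorHom ρ t)).flip.compl₁₂
        act act : PartitionHom K (n : K) r s →ₗ[K] PartitionHom K (n : K) s t →ₗ[K] _) := by
    refine PartitionHom.hom_ext fun x => PartitionHom.hom_ext fun y => LinearMap.ext fun f => ?_
    simp only [LinearMap.compr₂_apply, LinearMap.compl₁₂_apply, LinearMap.flip_apply,
      LinearMap.llcomp_apply, PartitionHom.mul_of, map_smul, act, PartitionHom.lift_of,
      LinearMap.smul_apply]
    exact Representation.IntertwiningMap.ext <| LinearMap.ext fun w =>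
      (congr($(evalDiagram_comp x y) (f.toLinearMap w))).symm
  exact congr($h x y f)

/-- `Hom_{𝔖_n}(W, ⊗^r V)` is a right module over the partition algebra `D_r` with `δ = n`. -/
noncomputable instance instModule :
    Module (PartitionAlgebra K (n : K) r)ᵐᵒᵖ (TensorHom ρ r) where
  smul x f := act x.unop f
  one_smul f := by
    change act (PartitionHom.of (PartitionDiagram.ofPerm 1)) f = f
    rw [act, PartitionHom.lift_of]
    exact Representation.IntertwiningMap.ext <| LinearMap.ext fun w =>
      evalDiagram_one (f.toLinearMap w)
  mul_smul x y v := act_mul y.unop x.unop v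
  smul_zero x := map_zero (act x.unop)
  smul_add x := map_add (act x.unop)
  add_smul x y v := act.map_add₂ x.unop y.unop v
  zero_smul v := act.map_zero₂ v

end TensorHom

end Multiplicity

section Specht

/-- The partition with its first (largest) part removed; the empty partition is kept. -/
def YoungDiagram.removeFirstRow (μ : YoungDiagram) : YoungDiagram where
  cells := (μ.cells.filter fun c => c.1 ≠ 0).image fun c => (c.1 - 1, c.2)
  isLowerSet := by
    rintro a b hab ha
    simp only [Finset.coe_image, Finset.coe_filter, Set.mem_image, Set.mem_ofPred_eq] at ha ⊢
    obtain ⟨c, ⟨hc, hc0⟩, rfl⟩ := ha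
    refine ⟨(b.1 + 1, b.2), ⟨μ.isLowerSet (show (b.1 + 1, b.2) ≤ c from ⟨?_, hab.2⟩) hc, ?_⟩, ?_⟩
    · have : b.1 ≤ c.1 - 1 := hab.1
      change b.1 + 1 ≤ c.1
      omega
    · simp
    · simp

theorem YoungDiagram.rowLen_removeFirstRow (μ : YoungDiagram) (i : ℕ) :
    μ.removeFirstRow.rowLen i = μ.rowLen (i + 1) := by
  refine eq_of_forall_lt_iff fun j => ?_
  rw [← YoungDiagram.mem_iff_lt_rowLen, ← YoungDiagram.mem_iff_lt_rowLen,
    ← YoungDiagram.mem_cells, ← YoungDiagram.mem_cells]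
  simp only [YoungDiagram.removeFirstRow, Finset.mem_image, Finset.mem_filter, Prod.exists,
    Prod.mk.injEq]
  constructor
  · rintro ⟨a, b, ⟨h, h0⟩, h1, rfl⟩
    obtain rfl : a = i + 1 := by omega
    exact h
  · exact fun h => ⟨i + 1, j, ⟨h, by simp⟩, by simp, rfl⟩

variable (K : Type*) [CommRing K] {n : ℕ} {μ : YoungDiagram} (T : Fin n ≃ μ.cells)

/-- The sum of the permutations that preserve the rows of the tableau `T`. -/
noncomputable def rowSymmetrizer : MonoidAlgebra K (Equiv.Perm (Fin n)) :=
  ∑ σ : Equiv.Perm (Fin n) with ∀ i, (T (σ i)).1.1 = (T i).1.1, MonoidAlgebra.single σ 1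

/-- The signed sum of the permutations that preserve the columns of the tableau `T`. -/
noncomputable def colAntisymmetrizer : MonoidAlgebra K (Equiv.Perm (Fin n)) :=
  ∑ σ : Equiv.Perm (Fin n) with ∀ i, (T (σ i)).1.2 = (T i).1.2,
    MonoidAlgebra.single σ ((Equiv.Perm.sign σ : ℤ) : K)

/-- The Specht module `S^μ`, as the left ideal of `K[𝔖_n]` generated by the Young symmetrizer of a
tableau `T` of shape `μ` (a bijective filling of `μ` with `n` labels). Over a field of
characteristic zero it is the irreducible representation of `𝔖_n` indexed by `μ`; tableaux of the
same shape give isomorphic representations. -/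
noncomputable def spechtModule :
    Submodule (MonoidAlgebra K (Equiv.Perm (Fin n))) (MonoidAlgebra K (Equiv.Perm (Fin n))) :=
  Submodule.span _ {rowSymmetrizer K T * colAntisymmetrizer K T}

/-- The representation of `𝔖_n` on the Specht module, by left multiplication. -/
noncomputable def spechtRep : Representation K (Equiv.Perm (Fin n)) (spechtModule K T) :=
  Representation.ofModule' (spechtModule K T)

end Specht

/-!
Write `H_r = Hom(S^μ, ⊗^r V)`. The isomorphism is the inverse of the map
`S^{μ̃} ⊗ K D(p, r; p) → H_r`, `w ⊗ x ↦ θ(w) · x`, for an isomorphism `θ : S^{μ̃} ≅ H_p` of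
`𝔖_p`-modules. Naturality is then built in, and the following has to be shown. Throughout, `a` and
`b` are the row symmetrizer and the column antisymmetrizer of `T`, so that `S^μ` is the left ideal
generated by `a b`, and `n - p` is the number of columns of `T`.

* A diagram with fewer than `p` propagating blocks kills every `f ∈ H_r`
  (`TensorHom.act_of_eq_zero`), so the map is well defined (`inflationLift`). By Maschke's theorem
  `f(a b)` has the form `a b v`. For a labelling of the upper vertices, the propagating vertices
  carry fewer than `p` labels, hence two other labels share a column; exchanging them fixes the
  image of the corresponding basis vector, which is therefore killed by `b`. For `r < p` the
  identity diagram shows `H_r = 0`.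

* If `p + r ≤ n`, evaluation identifies `K D(p, r)` with the equivariant maps from `⊗^p V` to
  `⊗^r V` (`evalHom_injective`, `exists_evalHom_eq`): the matrix entries of an equivariant map are a
  function of the kernel of the labelling, every set partition is such a kernel, and the zeta matrix
  of the lattice of set partitions is invertible.

* `S^μ` is a direct summand of `⊗^p V` (`exists_splitting`), say with inclusion `g ∈ H_p` and
  projection `π`. Each `f ∈ H_r` then equals `g · x` where `x ∈ K D(p, r)` is the unique morphism
  that evaluates to `f ∘ π`; this gives surjectivity, and uniqueness of `x` gives injectivity
  (`inflationLift_bijective`).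

* `θ` exists (`bottomEquiv`). An element `f ∈ H_p` is determined by the coefficients of `f(a b)` at
  the labellings by the labels below the first row of `T`: the other coefficients follow from these
  by row invariance, and because diagrams with fewer than `p` propagating blocks kill `f(a b)`
  (`eq_zero_of_lowerPart_eq_zero`). This identifies `H_p` with the left ideal of `K[𝔖_p]` generated
  by `b' a'`, where `a'` and `b'` are the symmetrizers of `T'`, and right multiplication by `a'`
  maps `S^{μ̃}` onto the same ideal.

The last two points use that right multiplication by the row symmetrizer is injective on a Specht
module. This follows from `a b ∈ a b a K[𝔖_n]` (`exists_row_col_row_mul`), which holds over `ℚ`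
because the standard bilinear form on a rational group algebra is positive definite. Irreducibility
of the Specht modules is not needed.
-/


/-! ### Reversal in group algebras and positivity -/

namespace MonoidAlgebra

open MulOpposite

section Reverse

variable {K G : Type*} [CommRing K] [Group G]

/-- The anti-automorphism of a group algebra that sends each group element to its inverse, as an
algebra homomorphism into the opposite algebra. -/
noncomputable def reverseHom : MonoidAlgebra K G →ₐ[K] (MonoidAlgebra K G)ᵐᵒᵖ :=
  MonoidAlgebra.lift K _ G
    { toFun := fun g => op (single g⁻¹ 1)
      map_one' := by simp [one_def]
      map_mul' := fun g h => by simp [← op_mul] }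

/-- The image of an element of a group algebra under inversion of the group elements. -/
noncomputable def reverse (x : MonoidAlgebra K G) : MonoidAlgebra K G := unop (reverseHom x)

@[simp]
theorem reverse_single (g : G) (c : K) : reverse (single g c) = single g⁻¹ c := by
  simp [reverse, reverseHom, lift_single]

@[simp]
theorem reverse_mul (x y : MonoidAlgebra K G) : reverse (x * y) = reverse y * reverse x := by
  simp [reverse]

@[simp]
theorem reverse_add (x y : MonoidAlgebra K G) : reverse (x + y) = reverse x + reverse y := by
  simp [reverse]

@[simp]
theorem reverse_zero : reverse (0 : MonoidAlgebra K G) = 0 := by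
  simp [reverse]

theorem reverse_sum {ι : Type*} (s : Finset ι) (f : ι → MonoidAlgebra K G) :
    reverse (∑ i ∈ s, f i) = ∑ i ∈ s, reverse (f i) := by
  simp [reverse]

@[simp]
theorem reverse_reverse (x : MonoidAlgebra K G) : reverse (reverse x) = x := by
  induction x using induction_linear with
  | zero => simp
  | add x y hx hy => simp [hx, hy]
  | single g c => simp

/-- The coefficient of `reverse x * y` at the identity is the standard bilinear form, so that
`reverse x` acts from the left as the adjoint of `x`. -/
theorem coeff_one_reverse_mul [Fintype G] (x y : MonoidAlgebra K G) :
    (reverse x * y).coeff 1 = ∑ g, x.coeff g * y.coeff g := by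
  classical
  induction x using induction_linear with
  | zero => simp
  | add x x' hx hx' => simp [add_mul, hx, hx', Finset.sum_add_distrib]
  | single g c =>
    rw [reverse_single, ← mul_inv_cancel g⁻¹, inv_inv, coeff_single_mul_mul]
    rw [Finset.sum_eq_single g] <;> simp +contextual [eq_comm]

end Reverse

section Positivity

variable {G : Type*} [Group G] [Finite G]

theorem eq_zero_of_reverse_mul_self {x : MonoidAlgebra ℚ G} (h : reverse x * x = 0) : x = 0 := by
  have := Fintype.ofFinite G
  have h1 := coeff_one_reverse_mul x x
  rw [h, coeff_zero, Finsupp.zero_apply, eq_comm,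
    Finset.sum_eq_zero_iff_of_nonneg fun g _ => mul_self_nonneg _] at h1
  ext g
  simpa using h1 g (Finset.mem_univ g)

/-- Because the form `(x, y) ↦ ∑ g, x_g y_g` on a rational group algebra is positive definite, left
multiplication by `m` and by `m * reverse m * m` have the same kernel, hence the same image. -/
theorem exists_mul_reverse_mul_mul (m : MonoidAlgebra ℚ G) :
    ∃ y, m * reverse m * m * y = m := by
  have hker : LinearMap.ker (LinearMap.mulLeft ℚ (m * reverse m * m)) =
      LinearMap.ker (LinearMap.mulLeft ℚ m) := by
    ext z
    simp only [LinearMap.mem_ker, LinearMap.mulLeft_apply]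
    refine ⟨fun h => ?_, fun h => by rw [mul_assoc, h, mul_zero]⟩
    have h1 : reverse m * m * z = 0 := eq_zero_of_reverse_mul_self <| by
      calc reverse (reverse m * m * z) * (reverse m * m * z)
          = reverse z * reverse m * (m * reverse m * m * z) := by simp [mul_assoc]
        _ = 0 := by rw [h, mul_zero]
    exact eq_zero_of_reverse_mul_self <| by
      calc reverse (m * z) * (m * z) = reverse z * (reverse m * m * z) := by simp [mul_assoc]
        _ = 0 := by rw [h1, mul_zero]
  have hle : LinearMap.range (LinearMap.mulLeft ℚ (m * reverse m * m)) ≤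
      LinearMap.range (LinearMap.mulLeft ℚ m) := by
    rintro _ ⟨z, rfl⟩
    exact ⟨reverse m * m * z, by simp [mul_assoc]⟩
  have hfin : Module.Finite ℚ (MonoidAlgebra ℚ G) := inferInstance
  have heq := Submodule.eq_of_le_of_finrank_eq hle <| by
    have h1 := LinearMap.finrank_range_add_finrank_ker (LinearMap.mulLeft ℚ (m * reverse m * m))
    have h2 := LinearMap.finrank_range_add_finrank_ker (LinearMap.mulLeft ℚ m)
    rw [hker] at h1
    omega
  have hm : m ∈ LinearMap.range (LinearMap.mulLeft ℚ m) := ⟨1, by simp⟩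
  rwa [← heq] at hm

theorem exists_mul_mul_mul_eq {a b : MonoidAlgebra ℚ G} {c : ℚ} (ha : reverse a = a)
    (hb : reverse b = b) (hbb : b * b = c • b) : ∃ y, a * b * a * y = a * b := by
  obtain ⟨y, hy⟩ := exists_mul_reverse_mul_mul (a * b)
  refine ⟨c • (a * b * y), ?_⟩
  calc a * b * a * (c • (a * b * y)) = a * (c • b) * a * a * b * y := by
        simp [mul_assoc]
    _ = a * b * reverse (a * b) * (a * b) * y := by
        rw [reverse_mul, ha, hb, ← hbb]; simp only [mul_assoc]
    _ = a * b := hy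

end Positivity

end MonoidAlgebra

/-! ### Row symmetrizers and column antisymmetrizers -/

section Symmetrizers

open MonoidAlgebra

variable (K : Type*) [CommRing K] {n : ℕ} {μ : YoungDiagram} (T : Fin n ≃ μ.cells)

/-- The group of the permutations that preserve the rows of the tableau `T`. -/
def rowSubgroup : Subgroup (Equiv.Perm (Fin n)) where
  carrier := {σ | ∀ i, (T (σ i)).1.1 = (T i).1.1}
  mul_mem' hσ hτ i := (hσ _).trans (hτ i)
  one_mem' _ := rfl
  inv_mem' {σ} hσ i := by simpa using (hσ (σ⁻¹ i)).symm

/-- The group of the permutations that preserve the columns of the tableau `T`. -/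
def colSubgroup : Subgroup (Equiv.Perm (Fin n)) where
  carrier := {σ | ∀ i, (T (σ i)).1.2 = (T i).1.2}
  mul_mem' hσ hτ i := (hσ _).trans (hτ i)
  one_mem' _ := rfl
  inv_mem' {σ} hσ i := by simpa using (hσ (σ⁻¹ i)).symm

theorem rowSymmetrizer_eq [DecidablePred (· ∈ rowSubgroup T)] : rowSymmetrizer K T =
    ∑ σ : Equiv.Perm (Fin n) with σ ∈ rowSubgroup T, single σ (1 : K) := by
  unfold rowSymmetrizer
  congr!

theorem colAntisymmetrizer_eq [DecidablePred (· ∈ colSubgroup T)] : colAntisymmetrizer K T =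
    ∑ σ : Equiv.Perm (Fin n) with σ ∈ colSubgroup T,
      single σ ((Equiv.Perm.sign σ : ℤ) : K) := by
  unfold colAntisymmetrizer
  congr!

theorem rowSymmetrizer_mul_single {σ : Equiv.Perm (Fin n)} (hσ : σ ∈ rowSubgroup T) :
    rowSymmetrizer K T * single σ 1 = rowSymmetrizer K T := by
  classical
  rw [rowSymmetrizer_eq, Finset.sum_mul]
  refine Finset.sum_equiv (Equiv.mulRight σ) (fun τ => ?_) fun τ _ => by simp
  simp [Subgroup.mul_mem_cancel_right _ hσ]

theorem single_mul_rowSymmetrizer {σ : Equiv.Perm (Fin n)} (hσ : σ ∈ rowSubgroup T) :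
    single σ 1 * rowSymmetrizer K T = rowSymmetrizer K T := by
  classical
  rw [rowSymmetrizer_eq, Finset.mul_sum]
  refine Finset.sum_equiv (Equiv.mulLeft σ) (fun τ => ?_) fun τ _ => by simp
  simp [Subgroup.mul_mem_cancel_left _ hσ]

theorem colAntisymmetrizer_mul_single {σ : Equiv.Perm (Fin n)} (hσ : σ ∈ colSubgroup T) :
    colAntisymmetrizer K T * single σ 1 =
      ((Equiv.Perm.sign σ : ℤ) : K) • colAntisymmetrizer K T := by
  classical
  rw [colAntisymmetrizer_eq, Finset.sum_mul, Finset.smul_sum]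
  refine Finset.sum_equiv (Equiv.mulRight σ) (fun τ => ?_) fun τ _ => ?_
  · simp [Subgroup.mul_mem_cancel_right _ hσ]
  · rcases Int.units_eq_one_or (Equiv.Perm.sign σ) with h | h <;> simp [h]

theorem reverse_rowSymmetrizer : reverse (rowSymmetrizer K T) = rowSymmetrizer K T := by
  classical
  rw [rowSymmetrizer_eq, reverse_sum]
  exact Finset.sum_equiv (Equiv.inv _) (fun τ => by simp) fun τ _ => by simp

theorem reverse_colAntisymmetrizer :
    reverse (colAntisymmetrizer K T) = colAntisymmetrizer K T := by
  classical
  rw [colAntisymmetrizer_eq, reverse_sum]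
  exact Finset.sum_equiv (Equiv.inv _) (fun τ => by simp) fun τ _ => by simp

theorem colAntisymmetrizer_mul_self :
    ∃ c : K, colAntisymmetrizer K T * colAntisymmetrizer K T = c • colAntisymmetrizer K T := by
  classical
  refine ⟨Finset.card {σ : Equiv.Perm (Fin n) | σ ∈ colSubgroup T}, ?_⟩
  conv_lhs => enter [2]; rw [colAntisymmetrizer_eq]
  rw [Finset.mul_sum, Nat.cast_smul_eq_nsmul, ← Finset.sum_const]
  refine Finset.sum_congr rfl fun σ hσ => ?_
  have h1 : single σ ((Equiv.Perm.sign σ : ℤ) : K) =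
      ((Equiv.Perm.sign σ : ℤ) : K) • single σ (1 : K) := by simp
  rw [h1, mul_smul_comm, colAntisymmetrizer_mul_single K T (Finset.mem_filter.1 hσ).2, smul_smul]
  rcases Int.units_eq_one_or (Equiv.Perm.sign σ) with h | h <;> simp [h]

variable {K T} in
theorem mem_spechtModule {x : MonoidAlgebra K (Equiv.Perm (Fin n))} :
    x ∈ spechtModule K T ↔ ∃ y, y * (rowSymmetrizer K T * colAntisymmetrizer K T) = x :=
  Submodule.mem_span_singleton

/-- The Young symmetrizer as an element of the Specht module. -/
noncomputable def spechtGen : spechtModule K T :=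
  ⟨rowSymmetrizer K T * colAntisymmetrizer K T, Submodule.mem_span_singleton_self _⟩

variable {K T} in
theorem spechtRep_apply (g : Equiv.Perm (Fin n)) (x : spechtModule K T) :
    spechtRep K T g x = (single g 1 : MonoidAlgebra K _) • x := rfl

variable {K T}
variable {V : Type*} [AddCommMonoid V] [Module K V] {ρ : Representation K (Equiv.Perm (Fin n)) V}

theorem intertwining_smul (f : (spechtRep K T).IntertwiningMap ρ)
    (y : MonoidAlgebra K (Equiv.Perm (Fin n))) (x : spechtModule K T) :
    f (y • x) = ρ.asAlgebraHom y (f x) := by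
  induction y using induction_linear with
  | zero => simp
  | add y z hy hz => simp [add_smul, hy, hz]
  | single g c =>
    have : (single g c : MonoidAlgebra K (Equiv.Perm (Fin n))) • x =
        c • spechtRep K T g x := by
      rw [spechtRep_apply, ← smul_assoc]; simp
    rw [this, map_smul, f.isIntertwining, Representation.asAlgebraHom_single,
      LinearMap.smul_apply]

theorem intertwining_ext {f f' : (spechtRep K T).IntertwiningMap ρ}
    (h : f (spechtGen K T) = f' (spechtGen K T)) : f = f' := by
  refine Representation.IntertwiningMap.ext <| LinearMap.ext fun x => ?_
  obtain ⟨y, hy⟩ := mem_spechtModule.1 x.2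
  have hx : x = y • spechtGen K T := Subtype.ext hy.symm
  change f x = f' x
  rw [hx, intertwining_smul, intertwining_smul, h]

end Symmetrizers

section Retraction

open MonoidAlgebra

variable (K : Type*) [Field K] [CharZero K] {n : ℕ} {μ : YoungDiagram} (T : Fin n ≃ μ.cells)

/-- The identity holds over `ℚ`, and the symmetrizers have rational coefficients. -/
theorem exists_row_col_row_mul : ∃ y, rowSymmetrizer K T * colAntisymmetrizer K T *
    rowSymmetrizer K T * y = rowSymmetrizer K T * colAntisymmetrizer K T := by
  obtain ⟨c, hc⟩ := colAntisymmetrizer_mul_self ℚ T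
  obtain ⟨y, hy⟩ := exists_mul_mul_mul_eq (reverse_rowSymmetrizer ℚ T)
    (reverse_colAntisymmetrizer ℚ T) hc
  let F := MonoidAlgebra.mapRingHom (Equiv.Perm (Fin n)) (algebraMap ℚ K)
  have ha : F (rowSymmetrizer ℚ T) = rowSymmetrizer K T := by
    simp [F, rowSymmetrizer]
  have hb : F (colAntisymmetrizer ℚ T) = colAntisymmetrizer K T := by
    simp [F, colAntisymmetrizer]
  refine ⟨F y, ?_⟩
  rw [← ha, ← hb, ← map_mul, ← map_mul, ← map_mul, hy]

theorem exists_mul_row_col_row : ∃ y, y * (rowSymmetrizer K T * colAntisymmetrizer K T *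
    rowSymmetrizer K T) = colAntisymmetrizer K T * rowSymmetrizer K T := by
  obtain ⟨y, hy⟩ := exists_row_col_row_mul K T
  refine ⟨reverse y, ?_⟩
  have := congrArg reverse hy
  simpa [reverse_rowSymmetrizer, reverse_colAntisymmetrizer, mul_assoc] using this

/-- Like every left ideal of the group algebra, the Specht module has a right unit. -/
theorem exists_spechtModule_rightUnit :
    ∃ u : spechtModule K T, ∀ x : spechtModule K T,
      (x : MonoidAlgebra K (Equiv.Perm (Fin n))) • u = x := by
  obtain ⟨f, hf⟩ := MonoidAlgebra.exists_leftInverse_of_injective (spechtModule K T).subtype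
    (spechtModule K T).ker_subtype
  refine ⟨f 1, fun x => ?_⟩
  rw [← map_smul, smul_eq_mul, mul_one]
  exact congr($hf x)

variable {K T}

theorem exists_intertwining_spechtGen {V : Type*} [AddCommMonoid V] [Module K V]
    {ρ : Representation K (Equiv.Perm (Fin n)) V} (f : (spechtRep K T).IntertwiningMap ρ) :
    ∃ v, f (spechtGen K T) =
      ρ.asAlgebraHom (rowSymmetrizer K T) (ρ.asAlgebraHom (colAntisymmetrizer K T) v) := by
  obtain ⟨u, hu⟩ := exists_spechtModule_rightUnit K T
  refine ⟨f u, ?_⟩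
  conv_lhs => rw [← hu (spechtGen K T)]
  rw [intertwining_smul, spechtGen, map_mul]
  rfl

/-- Right multiplication by the row symmetrizer of a tableau of shape `μ` is an injective map on
the Specht module. -/
theorem eq_zero_of_mul_rowSymmetrizer {x : MonoidAlgebra K (Equiv.Perm (Fin n))}
    (hx : x ∈ spechtModule K T) (h : x * rowSymmetrizer K T = 0) : x = 0 := by
  obtain ⟨y, rfl⟩ := mem_spechtModule.1 hx
  obtain ⟨z, hz⟩ := exists_row_col_row_mul K T
  rw [← hz, ← mul_assoc, ← mul_assoc y, h, zero_mul]

end Retraction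

/-! ### Equivariant maps into tensor powers -/

namespace TensorHom

variable {K : Type*} [CommRing K] {n r s : ℕ} {W : Type*} [AddCommGroup W] [Module K W]
  {ρ : Representation K (Equiv.Perm (Fin n)) W}

/-- The linear map underlying an element of `Hom_{𝔖_n}(W, ⊗^r V)`. -/
noncomputable def toLin : TensorHom ρ r →ₗ[K] W →ₗ[K] tensorSpace K n r where
  toFun f := Representation.IntertwiningMap.toLinearMap f
  map_add' _ _ := rfl
  map_smul' _ _ := rfl

theorem toLin_injective : Function.Injective (toLin : TensorHom ρ r →ₗ[K] _) :=
  Representation.IntertwiningMap.toLinearMap_injective ρ (tensorRep K n r)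

theorem toLin_act_of (x : PartitionDiagram r s) (f : TensorHom ρ r) (w : W) :
    toLin (act (PartitionHom.of x) f) w = evalDiagram K n x (toLin f w) := by
  rw [act, PartitionHom.lift_of]
  rfl

theorem toLin_rho (f : TensorHom ρ r) (g : Equiv.Perm (Fin n)) (w : W) :
    toLin f (ρ g w) = tensorRep K n r g (toLin f w) :=
  Representation.IntertwiningMap.isIntertwining ρ (tensorRep K n r) f g w

end TensorHom

/-! ### Diagrams with few propagating blocks -/

section Vanishing

open MonoidAlgebra

variable {n p r s : ℕ} {μ : YoungDiagram}

theorem PartitionDiagram.pr_le_right (x : PartitionDiagram r s) : x.pr ≤ s := by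
  have := x.pr_comp_le_right (ofPerm 1)
  rw [x.comp_one] at this
  exact this.trans (ofPerm 1).pr_le_left

theorem card_eq_add_rowLen (T : Fin n ≃ μ.cells) (T' : Fin p ≃ μ.removeFirstRow.cells) :
    n = p + μ.rowLen 0 := by
  have hn : n = μ.cells.card := by simpa using Fintype.card_congr T
  have hp : p = μ.removeFirstRow.cells.card := by simpa using Fintype.card_congr T'
  have h1 : μ.removeFirstRow.cells.card = (μ.cells.filter fun c => c.1 ≠ 0).card := by
    refine Finset.card_image_of_injOn ?_
    rintro ⟨a, b⟩ h ⟨a', b'⟩ h' heq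
    simp only [Finset.coe_filter, Set.mem_ofPred_eq, Prod.mk.injEq] at h h' heq
    ext <;> simp <;> omega
  rw [hn, hp, h1, YoungDiagram.rowLen_eq_card, YoungDiagram.row,
    ← Finset.card_filter_add_card_filter_not (s := μ.cells) (fun c => c.1 ≠ 0)]
  simp

theorem snd_lt_rowLen_zero (T : Fin n ≃ μ.cells) (l : Fin n) : (T l).1.2 < μ.rowLen 0 :=
  (YoungDiagram.mem_iff_lt_rowLen.1 ((YoungDiagram.mem_cells _).1 (T l).2)).trans_le
    (μ.rowLen_anti _ _ (Nat.zero_le _))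

variable {K : Type*} [Field K] [CharZero K]

theorem colAntisymmetrizer_apply_eq_zero {V : Type*} [AddCommMonoid V] [Module K V]
    {ρ : Representation K (Equiv.Perm (Fin n)) V} (T : Fin n ≃ μ.cells) {a b : Fin n}
    (hab : a ≠ b) (hcol : (T a).1.2 = (T b).1.2) {v : V} (hv : ρ (Equiv.swap a b) v = v) :
    ρ.asAlgebraHom (colAntisymmetrizer K T) v = 0 := by
  have hmem : Equiv.swap a b ∈ colSubgroup T := fun i => by
    rcases eq_or_ne i a with rfl | hia
    · rw [Equiv.swap_apply_left, hcol]
    rcases eq_or_ne i b with rfl | hib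
    · rw [Equiv.swap_apply_right, hcol]
    · rw [Equiv.swap_apply_of_ne_of_ne hia hib]
  have h1 := congr(ρ.asAlgebraHom $(colAntisymmetrizer_mul_single K T hmem) v)
  rw [map_mul, Module.End.mul_apply, Representation.asAlgebraHom_single_one, hv,
    Equiv.Perm.sign_swap hab] at h1
  simp only [Units.val_neg, Units.val_one, Int.cast_neg, Int.cast_one, map_smul,
    LinearMap.smul_apply] at h1
  calc ρ.asAlgebraHom (colAntisymmetrizer K T) v
      = (2⁻¹ : K) • (ρ.asAlgebraHom (colAntisymmetrizer K T) v +
          ρ.asAlgebraHom (colAntisymmetrizer K T) v) := by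
        rw [← two_smul K, inv_smul_smul₀ two_ne_zero]
    _ = (2⁻¹ : K) • ((1 + -1 : K) • ρ.asAlgebraHom (colAntisymmetrizer K T) v) := by
        rw [add_smul, one_smul, ← h1]
    _ = 0 := by rw [add_neg_cancel, zero_smul, smul_zero]

omit [CharZero K] in
theorem evalDiagram_asAlgebraHom (x : PartitionDiagram r s)
    (y : MonoidAlgebra K (Equiv.Perm (Fin n))) (v : tensorSpace K n r) :
    evalDiagram K n x ((tensorRep K n r).asAlgebraHom y v) =
      (tensorRep K n s).asAlgebraHom y (evalDiagram K n x v) := by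
  induction y using induction_linear with
  | zero => simp
  | add y z hy hz => simp [hy, hz]
  | single g c => simp [evalDiagram_tensorRep]

/-- If `x` has fewer than `p` propagating blocks and `n - p` is the number of columns of `T`, then
the labels of the propagating vertices in a labelling that is constant on blocks leave so many
labels free that two of these lie in the same column. -/
theorem exists_ne_same_column (T : Fin n ≃ μ.cells) (hn : n = p + μ.rowLen 0)
    {x : PartitionDiagram r s} (hx : x.pr < p) {i : Fin r → Fin n}
    (hi : ∀ k l, x (Sum.inl k) (Sum.inl l) → i k = i l) :
    ∃ a b : Fin n, a ≠ b ∧ (T a).1.2 = (T b).1.2 ∧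
      ∀ k m, x (Sum.inl k) (Sum.inr m) → i k ≠ a ∧ i k ≠ b := by
  classical
  let X : Finset (Fin n) := Finset.univ.filter fun l => ∃ k j, x (Sum.inl k) (Sum.inr j) ∧ i k = l
  have hX : ∀ l : X, ∃ k, (∃ j, x (Sum.inl k) (Sum.inr j)) ∧ i k = l := fun l => by
    obtain ⟨k, j, h1, h2⟩ := (Finset.mem_filter.1 l.2).2
    exact ⟨k, ⟨j, h1⟩, h2⟩
  choose κ hκ hκ' using hX
  have hcard : X.card ≤ x.pr := by
    rw [← Fintype.card_coe, ← Nat.card_eq_fintype_card]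
    refine Nat.card_le_card_of_injective (fun l => ⟨Quotient.mk x (Sum.inl (κ l)), ⟨_, rfl⟩,
      (hκ l).imp fun j hj => Quotient.sound (x.symm hj)⟩) fun l l' h => ?_
    have h1 := hi _ _ (Quotient.exact (congrArg Subtype.val h))
    rw [hκ', hκ'] at h1
    exact Subtype.ext h1
  obtain ⟨a, ha, b, hb, hab, hcol⟩ := Finset.exists_ne_map_eq_of_card_lt_of_maps_to
    (s := Xᶜ) (t := Finset.range (μ.rowLen 0)) (f := fun l => (T l).1.2)
    (by rw [Finset.card_compl, Fintype.card_fin, Finset.card_range]; omega)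
    (fun l _ => by simpa using snd_lt_rowLen_zero T l)
  refine ⟨a, b, hab, hcol, fun k m hkm => ⟨?_, ?_⟩⟩
  · rintro rfl
    exact Finset.mem_compl.1 ha (Finset.mem_filter.2 ⟨Finset.mem_univ _, k, m, hkm, rfl⟩)
  · rintro rfl
    exact Finset.mem_compl.1 hb (Finset.mem_filter.2 ⟨Finset.mem_univ _, k, m, hkm, rfl⟩)

theorem PartitionDiagram.coeff_swap {x : PartitionDiagram r s} {a b : Fin n} {i : Fin r → Fin n}
    (h : ∀ k m, x (Sum.inl k) (Sum.inr m) → i k ≠ a ∧ i k ≠ b) (j : Fin s → Fin n) :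
    x.coeff (Equiv.swap a b ∘ i) j = x.coeff i j := by
  have hfix : ∀ k m, x (Sum.inl k) (Sum.inr m) → Equiv.swap a b (i k) = i k := fun k m hkm =>
    Equiv.swap_apply_of_ne_of_ne (h k m hkm).1 (h k m hkm).2
  have key : ∀ u w, x u w → (Sum.elim (Equiv.swap a b ∘ i) j u =
      Sum.elim (Equiv.swap a b ∘ i) j w ↔ Sum.elim i j u = Sum.elim i j w) := by
    rintro (u | u) (w | w) huw
    · exact (Equiv.swap a b).injective.eq_iff
    · simp [hfix u w huw]
    · simp [hfix w u (x.symm huw)]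
    · rfl
  have hiff : x.Compat (Equiv.swap a b ∘ i) j ↔ x.Compat i j :=
    ⟨fun h u w huw => (key u w huw).1 (h huw), fun h u w huw => (key u w huw).2 (h huw)⟩
  unfold coeff
  by_cases hc : x.Compat i j
  · rw [if_pos hc, if_pos (hiff.2 hc)]
  · rw [if_neg hc, if_neg (mt hiff.1 hc)]

/-- The image of a diagram with fewer than `p` propagating blocks is killed by the column
antisymmetrizer of a tableau with `n - p` columns: on each basis vector the evaluation is zero, or
it is fixed by a transposition of two labels in the same column. -/
theorem colAntisymmetrizer_evalDiagram (T : Fin n ≃ μ.cells) (hn : n = p + μ.rowLen 0)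
    {x : PartitionDiagram r s} (hx : x.pr < p) (v : tensorSpace K n r) :
    (tensorRep K n s).asAlgebraHom (colAntisymmetrizer K T) (evalDiagram K n x v) = 0 := by
  suffices h : (tensorRep K n s).asAlgebraHom (colAntisymmetrizer K T) ∘ₗ evalDiagram K n x = 0 from
    LinearMap.congr_fun h v
  refine (tensorBasis K n r).ext fun i => ?_
  rw [LinearMap.comp_apply, LinearMap.zero_apply]
  by_cases hi : ∀ k l, x (Sum.inl k) (Sum.inl l) → i k = i l
  · obtain ⟨a, b, hab, hcol, h⟩ := exists_ne_same_column T hn hx hi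
    refine colAntisymmetrizer_apply_eq_zero T hab hcol ?_
    rw [← evalDiagram_tensorRep, tensorRep_basis, evalDiagram_basis, evalDiagram_basis]
    exact Finset.sum_congr rfl fun j _ => by rw [PartitionDiagram.coeff_swap h]
  · push Not at hi
    obtain ⟨k, l, hkl, hne⟩ := hi
    rw [evalDiagram_basis, Finset.sum_eq_zero, map_zero]
    intro j _
    rw [PartitionDiagram.coeff, if_neg (fun h : x.Compat i j => hne (h hkl)), Nat.cast_zero,
      zero_smul]

omit [CharZero K] in
theorem TensorHom.ext_spechtGen {T : Fin n ≃ μ.cells} {f f' : TensorHom (spechtRep K T) r}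
    (h : toLin f (spechtGen K T) = toLin f' (spechtGen K T)) : f = f' :=
  intertwining_ext (ρ := tensorRep K n r) h

theorem TensorHom.exists_toLin_spechtGen {T : Fin n ≃ μ.cells} (f : TensorHom (spechtRep K T) r) :
    ∃ v, toLin f (spechtGen K T) = (tensorRep K n r).asAlgebraHom (rowSymmetrizer K T)
      ((tensorRep K n r).asAlgebraHom (colAntisymmetrizer K T) v) :=
  exists_intertwining_spechtGen (ρ := tensorRep K n r) f

/-- A map from the Specht module sends the Young symmetrizer into the image of the row symmetrizer
times the column antisymmetrizer, and both commute with the evaluation of diagrams. -/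
theorem TensorHom.act_of_eq_zero (T : Fin n ≃ μ.cells) (hn : n = p + μ.rowLen 0)
    {x : PartitionDiagram r s} (hx : x.pr < p) (f : TensorHom (spechtRep K T) r) :
    TensorHom.act (PartitionHom.of x) f = 0 := by
  refine TensorHom.ext_spechtGen ?_
  obtain ⟨v, hv⟩ := f.exists_toLin_spechtGen
  rw [toLin_act_of, hv, evalDiagram_asAlgebraHom, evalDiagram_asAlgebraHom,
    colAntisymmetrizer_evalDiagram T hn hx, map_zero, map_zero, LinearMap.zero_apply]

theorem TensorHom.eq_zero_of_lt (T : Fin n ≃ μ.cells) (hn : n = p + μ.rowLen 0) (hr : r < p)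
    (f : TensorHom (spechtRep K T) r) : f = 0 := by
  have h := TensorHom.act_of_eq_zero T hn
    ((PartitionDiagram.ofPerm (1 : Equiv.Perm (Fin r))).pr_le_left.trans_lt hr) f
  exact (one_smul (PartitionAlgebra K (n : K) r)ᵐᵒᵖ f).symm.trans h

end Vanishing

/-! ### Diagrams and equivariant maps between tensor powers -/

instance {X : Type*} [Finite X] : Finite (Setoid X) :=
  Finite.of_injective (fun (σ : Setoid X) a b => σ a b) fun σ τ h => by
    ext a b
    exact iff_of_eq (congrFun (congrFun h a) b)

section Zeta

variable (K : Type*) [Field K] (P : Type*) [Fintype P] [PartialOrder P] [DecidableLE P]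

/-- Summation of a function on a finite partially ordered set over the lower intervals. -/
def lowerSum : (P → K) →ₗ[K] (P → K) where
  toFun c := fun y => ∑ x with x ≤ y, c x
  map_add' _ _ := funext fun _ => Finset.sum_add_distrib
  map_smul' a _ := funext fun _ => (Finset.smul_sum (r := a)).symm

variable {K P} in
theorem lowerSum_apply (c : P → K) (y : P) : lowerSum K P c y = ∑ x with x ≤ y, c x := rfl

theorem lowerSum_injective : Function.Injective (lowerSum K P) := by
  classical
  refine (injective_iff_map_eq_zero _).2 fun c hc => funext fun y => ?_
  induction y using WellFoundedLT.induction with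
  | ind y ih =>
    have h := congrFun hc y
    rw [lowerSum_apply, Pi.zero_apply] at h
    rwa [Finset.sum_eq_single y (fun x hx hxy => ih x
      (lt_of_le_of_ne (Finset.mem_filter.1 hx).2 hxy)) (fun hy => absurd (by simp) hy)] at h

theorem lowerSum_surjective : Function.Surjective (lowerSum K P) :=
  LinearMap.injective_iff_surjective.1 (lowerSum_injective K P)

end Zeta

section Kernels

variable {X : Type*} {n : ℕ}

/-- Two labellings with the same kernel lie in the same `𝔖_n`-orbit. -/
theorem exists_perm_comp_eq_of_ker_eq {k k' : X → Fin n} (h : Setoid.ker k = Setoid.ker k') :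
    ∃ g : Equiv.Perm (Fin n), g ∘ k = k' := by
  classical
  let e : {a // a ∈ Set.range k} ≃ {a // a ∈ Set.range k'} :=
    (Setoid.quotientKerEquivRange k).symm.trans
      ((Quotient.congrRight fun a b => by rw [h]).trans (Setoid.quotientKerEquivRange k'))
  refine ⟨e.extendSubtype, funext fun a => ?_⟩
  rw [Function.comp_apply, Equiv.extendSubtype_apply_of_mem e _ ⟨a, rfl⟩]
  have h1 : (Setoid.quotientKerEquivRange k).symm ⟨k a, a, rfl⟩ = Quotient.mk _ a := by
    rw [Equiv.symm_apply_eq]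
    rfl
  change ((Setoid.quotientKerEquivRange k') (Quotient.congrRight _
    ((Setoid.quotientKerEquivRange k).symm ⟨k a, a, rfl⟩)) : Fin n) = k' a
  rw [h1]
  rfl

theorem exists_ker_eq [Fintype X] (h : Fintype.card X ≤ n) (σ : Setoid X) :
    ∃ k : X → Fin n, Setoid.ker k = σ := by
  classical
  obtain ⟨ι⟩ : Nonempty (Quotient σ ↪ Fin n) := Function.Embedding.nonempty_of_card_le <| by
    rw [Fintype.card_fin]
    exact (Fintype.card_quotient_le σ).trans h
  refine ⟨ι ∘ Quotient.mk σ, ?_⟩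
  ext a b
  rw [Setoid.ker_def]
  exact ι.injective.eq_iff.trans Quotient.eq

end Kernels

section Evaluation

variable {K : Type*} [Field K] {n r s t : ℕ}

/-- The evaluation of a morphism of the partition category with parameter `δ = n` as a linear map
between tensor powers of `V`. -/
noncomputable def evalHom :
    PartitionHom K (n : K) r s →ₗ[K] tensorSpace K n r →ₗ[K] tensorSpace K n s :=
  Finsupp.linearCombination K (evalDiagram K n)

theorem PartitionHom.hom_ext_addCommMonoid {δ : K} {M : Type*} [AddCommMonoid M] [Module K M]
    {f g : PartitionHom K δ r s →ₗ[K] M} (h : ∀ x, f (of x) = g (of x)) : f = g :=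
  Finsupp.lhom_ext' fun x => LinearMap.ext_ring (h x)

@[simp]
theorem evalHom_of (x : PartitionDiagram r s) :
    evalHom (PartitionHom.of x : PartitionHom K (n : K) r s) = evalDiagram K n x :=
  (Finsupp.linearCombination_single K 1 x).trans (one_smul _ _)

theorem evalHom_mul (x : PartitionHom K (n : K) r s) (y : PartitionHom K (n : K) s t) :
    evalHom (PartitionHom.mul x y) = evalHom y ∘ₗ evalHom x := by
  let L : PartitionHom K (n : K) r s →ₗ[K] PartitionHom K (n : K) s t →ₗ[K]
      tensorSpace K n r →ₗ[K] tensorSpace K n t := PartitionHom.mul.compr₂ evalHom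
  let R : PartitionHom K (n : K) r s →ₗ[K] PartitionHom K (n : K) s t →ₗ[K]
      tensorSpace K n r →ₗ[K] tensorSpace K n t :=
    (LinearMap.llcomp K (tensorSpace K n r) (tensorSpace K n s) (tensorSpace K n t)).flip.compl₁₂
      evalHom evalHom
  have h : L = R := by
    refine PartitionHom.hom_ext_addCommMonoid fun x =>
      PartitionHom.hom_ext_addCommMonoid fun y => ?_
    simp only [L, R, LinearMap.compr₂_apply, LinearMap.compl₁₂_apply, LinearMap.flip_apply,
      LinearMap.llcomp_apply', PartitionHom.mul_of, map_smul, evalHom_of]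
    exact (evalDiagram_comp x y).symm
  exact LinearMap.congr_fun (LinearMap.congr_fun h x) y

theorem TensorHom.toLin_act {W : Type*} [AddCommGroup W] [Module K W]
    {ρ : Representation K (Equiv.Perm (Fin n)) W} (x : PartitionHom K (n : K) r s)
    (f : TensorHom ρ r) : toLin (act x f) = evalHom x ∘ₗ toLin f := by
  let L : PartitionHom K (n : K) r s →ₗ[K] W →ₗ[K] tensorSpace K n s := toLin ∘ₗ act.flip f
  let R : PartitionHom K (n : K) r s →ₗ[K] W →ₗ[K] tensorSpace K n s :=
    LinearMap.lcomp K (tensorSpace K n s) (toLin f) ∘ₗ evalHom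
  have h : L = R := by
    refine PartitionHom.hom_ext_addCommMonoid fun x => LinearMap.ext fun w => ?_
    simp only [L, R, LinearMap.comp_apply, LinearMap.flip_apply, evalHom_of, toLin_act_of]
    rfl
  exact LinearMap.congr_fun h x

theorem repr_tensorRep (g : Equiv.Perm (Fin n)) (v : tensorSpace K n r) (i : Fin r → Fin n) :
    (tensorBasis K n r).repr (tensorRep K n r g v) (g ∘ i) = (tensorBasis K n r).repr v i := by
  suffices h : Finsupp.lapply (g ∘ i) ∘ₗ (tensorBasis K n r).repr.toLinearMap ∘ₗ
      tensorRep K n r g = Finsupp.lapply i ∘ₗ (tensorBasis K n r).repr.toLinearMap from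
    LinearMap.congr_fun h v
  refine (tensorBasis K n r).ext fun j => ?_
  have : g ∘ j = g ∘ i ↔ j = i := g.injective.comp_left.eq_iff
  simp [tensorRep_basis, Finsupp.single_apply, this]

theorem repr_evalDiagram_apply (d : PartitionDiagram r s) (u : tensorSpace K n r)
    (j : Fin s → Fin n) : (tensorBasis K n s).repr (evalDiagram K n d u) j =
      ∑ i, (tensorBasis K n r).repr u i * d.coeff i j := by
  classical
  conv_lhs => rw [← (tensorBasis K n r).sum_repr u]
  rw [map_sum, map_sum, Finsupp.finsetSum_apply]
  refine Finset.sum_congr rfl fun i _ => ?_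
  rw [map_smul, map_smul, Finsupp.smul_apply, smul_eq_mul, evalDiagram_basis, map_sum,
    Finsupp.finsetSum_apply, Finset.sum_eq_single j]
  · simp
  · intro k _ hk
    simp [hk]
  · simp

theorem repr_evalDiagram (d : PartitionDiagram r s) (k : Fin r ⊕ Fin s → Fin n)
    [Decidable (d ≤ Setoid.ker k)] :
    (tensorBasis K n s).repr (evalDiagram K n d (tensorBasis K n r (k ∘ Sum.inl))) (k ∘ Sum.inr) =
      if d ≤ Setoid.ker k then 1 else 0 := by
  classical
  rw [repr_evalDiagram_apply, Finset.sum_eq_single (k ∘ Sum.inl)]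
  · have h : d.Compat (k ∘ Sum.inl) (k ∘ Sum.inr) ↔ d ≤ Setoid.ker k := by
      rw [PartitionDiagram.Compat, Sum.elim_comp_inl_inr]
    unfold PartitionDiagram.coeff
    by_cases hc : d ≤ Setoid.ker k
    · simp [if_pos hc, if_pos (h.2 hc)]
    · simp [if_neg hc, if_neg (mt h.1 hc)]
  · intro j _ hj
    simp [hj.symm]
  · simp

open Classical in
theorem repr_evalHom [Fintype (PartitionDiagram r s)] (x : PartitionDiagram r s → K)
    (k : Fin r ⊕ Fin s → Fin n) :
    (tensorBasis K n s).repr (evalHom (∑ d, x d • PartitionHom.of d)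
      (tensorBasis K n r (k ∘ Sum.inl))) (k ∘ Sum.inr) =
        lowerSum K (PartitionDiagram r s) x (Setoid.ker k) := by
  rw [map_sum, LinearMap.sum_apply, map_sum, Finsupp.finsetSum_apply,
    lowerSum_apply, Finset.sum_filter]
  refine Finset.sum_congr rfl fun d _ => ?_
  have h : evalHom (x d • (PartitionHom.of d : PartitionHom K (n : K) r s)) =
      x d • evalDiagram K n d := by rw [map_smul, evalHom_of]
  refine (congrArg (fun L : tensorSpace K n r →ₗ[K] tensorSpace K n s => (tensorBasis K n s).repr
    (L (tensorBasis K n r (k ∘ Sum.inl))) (k ∘ Sum.inr)) h).trans ?_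
  simp [repr_evalDiagram]

theorem PartitionHom.exists_eq_sum [Fintype (PartitionDiagram r s)] {δ : K}
    (x : PartitionHom K δ r s) :
    ∃ c : PartitionDiagram r s → K, x = ∑ d, c d • PartitionHom.of d := by
  refine ⟨Finsupp.equivFunOnFinite (show PartitionDiagram r s →₀ K from x), ?_⟩
  have h := Finsupp.univ_sum_single (show PartitionDiagram r s →₀ K from x)
  refine Eq.trans h.symm (Finset.sum_congr rfl fun d _ => ?_)
  exact (Finsupp.smul_single_one d _).symm

/-- If there are at most `n` vertices, then every partition of them is the kernel of a labelling, so
the matrix entries give all sums of the coefficients over lower intervals. -/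
theorem evalHom_injective (h : r + s ≤ n) :
    Function.Injective (evalHom : PartitionHom K (n : K) r s →ₗ[K] _) := by
  classical
  have : Fintype (PartitionDiagram r s) := Fintype.ofFinite _
  refine (injective_iff_map_eq_zero _).2 fun x hx => ?_
  obtain ⟨c, rfl⟩ := x.exists_eq_sum
  suffices hc : c = 0 by simp [hc]
  refine lowerSum_injective K (PartitionDiagram r s) (funext fun σ => ?_)
  obtain ⟨k, rfl⟩ := exists_ker_eq (n := n) (by simpa using h) σ
  rw [← repr_evalHom, hx]
  simp

/-- The matrix entries of an equivariant map depend only on the kernel of the labelling, and every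
partition of the vertices is the kernel of a labelling if there are at most `n` vertices. -/
theorem exists_evalHom_eq (h : r + s ≤ n) (F : tensorSpace K n r →ₗ[K] tensorSpace K n s)
    (hF : ∀ g v, F (tensorRep K n r g v) = tensorRep K n s g (F v)) :
    ∃ x : PartitionHom K (n : K) r s, evalHom x = F := by
  classical
  have : Fintype (PartitionDiagram r s) := Fintype.ofFinite _
  let m : (Fin r ⊕ Fin s → Fin n) → K := fun k =>
    (tensorBasis K n s).repr (F (tensorBasis K n r (k ∘ Sum.inl))) (k ∘ Sum.inr)
  have hm : ∀ (g : Equiv.Perm (Fin n)) k, m (g ∘ k) = m k := fun g k => by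
    have h1 : ∀ v : tensorSpace K n s, (tensorBasis K n s).repr (tensorRep K n s g v)
        (g ∘ (k ∘ Sum.inr)) = (tensorBasis K n s).repr v (k ∘ Sum.inr) := fun v => by
      exact repr_tensorRep g v _
    simp only [m]
    rw [Function.comp_assoc, Function.comp_assoc, ← tensorRep_basis, hF, h1]
  choose κ hκ using exists_ker_eq (X := Fin r ⊕ Fin s) (n := n) (by simpa using h)
  obtain ⟨c, hc⟩ := lowerSum_surjective K (PartitionDiagram r s) fun σ => m (κ σ)
  refine ⟨∑ d, c d • PartitionHom.of d, (tensorBasis K n r).ext fun i => ?_⟩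
  refine (tensorBasis K n s).ext_elem fun j => ?_
  have h1 := repr_evalHom c (Sum.elim i j)
  obtain ⟨g, hg⟩ := exists_perm_comp_eq_of_ker_eq (hκ (Setoid.ker (Sum.elim i j)))
  rw [hc] at h1
  beta_reduce at h1
  rw [← hm g, hg, Sum.elim_comp_inl, Sum.elim_comp_inr] at h1
  simpa [m] using h1

end Evaluation

/-! ### Removing the first row of a tableau -/

section LowerRows

variable {n p : ℕ} {μ : YoungDiagram} (T : Fin n ≃ μ.cells) (T' : Fin p ≃ μ.removeFirstRow.cells)

theorem YoungDiagram.mem_removeFirstRow {μ : YoungDiagram} {i j : ℕ} :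
    (i, j) ∈ μ.removeFirstRow ↔ (i + 1, j) ∈ μ := by
  rw [mem_iff_lt_rowLen, mem_iff_lt_rowLen, rowLen_removeFirstRow]

/-- The label in `T` of the cell that carries the label `k` in `T'`, where the rows of `T'` are
the rows of `T` below the first one. -/
def lowerLabel (k : Fin p) : Fin n :=
  T.symm ⟨((T' k).1.1 + 1, (T' k).1.2), YoungDiagram.mem_removeFirstRow.1 (T' k).2⟩

theorem fst_lowerLabel (k : Fin p) : (T (lowerLabel T T' k)).1.1 = (T' k).1.1 + 1 := by
  simp [lowerLabel]

theorem snd_lowerLabel (k : Fin p) : (T (lowerLabel T T' k)).1.2 = (T' k).1.2 := by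
  simp [lowerLabel]

theorem lowerLabel_injective : Function.Injective (lowerLabel T T') := fun k l h => by
  have h1 := fst_lowerLabel T T' k
  have h2 := snd_lowerLabel T T' k
  rw [h, fst_lowerLabel] at h1
  rw [h, snd_lowerLabel] at h2
  exact T'.injective (Subtype.ext (Prod.ext (by omega) h2.symm))

theorem exists_lowerLabel_eq {l : Fin n} (hl : (T l).1.1 ≠ 0) : ∃ k, lowerLabel T T' k = l := by
  have h : ((T l).1.1 - 1, (T l).1.2) ∈ μ.removeFirstRow := by
    rw [YoungDiagram.mem_removeFirstRow, Nat.sub_add_cancel (Nat.pos_of_ne_zero hl)]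
    exact (T l).2
  refine ⟨T'.symm ⟨_, h⟩, ?_⟩
  rw [lowerLabel, Equiv.symm_apply_eq]
  ext
  · simp; omega
  · simp

/-- The labels of `T'` correspond to the labels of `T` below the first row. -/
noncomputable def lowerEquiv : Fin p ≃ {l : Fin n // (T l).1.1 ≠ 0} :=
  Equiv.ofBijective (fun k => ⟨lowerLabel T T' k, by rw [fst_lowerLabel]; omega⟩)
    ⟨fun _ _ h => lowerLabel_injective T T' (congrArg Subtype.val h), fun l =>
      (exists_lowerLabel_eq T T' l.2).imp fun _ hk => Subtype.ext hk⟩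

/-- A permutation of the labels of `T'` as a permutation of the labels of `T` that fixes the labels
in the first row. -/
noncomputable def extendLower (ρ : Equiv.Perm (Fin p)) : Equiv.Perm (Fin n) :=
  ρ.extendDomain (lowerEquiv T T')

theorem extendLower_lowerLabel (ρ : Equiv.Perm (Fin p)) (k : Fin p) :
    extendLower T T' ρ (lowerLabel T T' k) = lowerLabel T T' (ρ k) :=
  ρ.extendDomain_apply_image (lowerEquiv T T') k

theorem extendLower_of_fst_eq_zero (ρ : Equiv.Perm (Fin p)) {l : Fin n} (hl : (T l).1.1 = 0) :
    extendLower T T' ρ l = l :=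
  ρ.extendDomain_apply_not_subtype (lowerEquiv T T') (not_not.2 hl)

theorem extendLower_injective : Function.Injective (extendLower T T') :=
  Equiv.Perm.extendDomainHom_injective (lowerEquiv T T')

theorem sign_extendLower (ρ : Equiv.Perm (Fin p)) :
    Equiv.Perm.sign (extendLower T T' ρ) = Equiv.Perm.sign ρ :=
  Equiv.Perm.sign_extendDomain ρ (lowerEquiv T T')

theorem forall_label {P : Fin n → Prop} (h1 : ∀ k, P (lowerLabel T T' k))
    (h2 : ∀ l, (T l).1.1 = 0 → P l) (l : Fin n) : P l := by
  by_cases hl : (T l).1.1 = 0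
  · exact h2 l hl
  · obtain ⟨k, rfl⟩ := exists_lowerLabel_eq T T' hl
    exact h1 k

variable {T T'}

theorem extendLower_mem_rowSubgroup {ρ : Equiv.Perm (Fin p)} (h : ρ ∈ rowSubgroup T') :
    extendLower T T' ρ ∈ rowSubgroup T := by
  refine forall_label T T' (fun k => ?_) fun l hl => ?_
  · rw [extendLower_lowerLabel, fst_lowerLabel, fst_lowerLabel, h k]
  · rw [extendLower_of_fst_eq_zero T T' ρ hl]

theorem extendLower_mem_colSubgroup {ρ : Equiv.Perm (Fin p)} (h : ρ ∈ colSubgroup T') :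
    extendLower T T' ρ ∈ colSubgroup T := by
  refine forall_label T T' (fun k => ?_) fun l hl => ?_
  · rw [extendLower_lowerLabel, snd_lowerLabel, snd_lowerLabel, h k]
  · rw [extendLower_of_fst_eq_zero T T' ρ hl]

theorem exists_comp_lowerLabel_of_mem_rowSubgroup {g : Equiv.Perm (Fin n)}
    (hg : g ∈ rowSubgroup T) :
    ∃ ρ ∈ rowSubgroup T', g ∘ lowerLabel T T' = lowerLabel T T' ∘ ρ := by
  have h : ∀ k, ∃ k', lowerLabel T T' k' = g (lowerLabel T T' k) := fun k =>
    exists_lowerLabel_eq T T' (by rw [hg, fst_lowerLabel]; omega)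
  choose f hf using h
  have hinj : Function.Injective f := fun k l hkl => lowerLabel_injective T T' <|
    g.injective (by rw [← hf, ← hf, hkl])
  refine ⟨Equiv.ofBijective f (Finite.injective_iff_bijective.1 hinj), fun k => ?_,
    funext fun k => (hf k).symm⟩
  have h1 := hg (lowerLabel T T' k)
  rw [← hf, fst_lowerLabel, fst_lowerLabel] at h1
  exact Nat.succ_injective h1

/-- A column permutation that maps the labels below the first row to themselves fixes each label in
the first row, since it has to preserve the column of that label. -/
theorem exists_eq_extendLower {g : Equiv.Perm (Fin n)} (hg : g ∈ colSubgroup T)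
    {ρ : Equiv.Perm (Fin p)} (h : g ∘ lowerLabel T T' = lowerLabel T T' ∘ ρ) :
    ρ ∈ colSubgroup T' ∧ extendLower T T' ρ = g := by
  have h' : ∀ k, g (lowerLabel T T' k) = lowerLabel T T' (ρ k) := congrFun h
  refine ⟨fun k => ?_, Equiv.ext <| forall_label T T' (fun k => ?_) fun l hl => ?_⟩
  · have h1 := hg (lowerLabel T T' k)
    rwa [h', snd_lowerLabel, snd_lowerLabel] at h1
  · rw [extendLower_lowerLabel, h']
  · rw [extendLower_of_fst_eq_zero T T' ρ hl]
    have h0 : (T (g l)).1.1 = 0 := by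
      by_contra hne
      obtain ⟨k, hk⟩ := exists_lowerLabel_eq T T' hne
      have h2 : g (lowerLabel T T' (ρ⁻¹ k)) = g l := by rw [h', ← hk]; simp
      rw [← g.injective h2, fst_lowerLabel] at hl
      omega
    exact T.injective (Subtype.ext (Prod.ext (hl.trans h0.symm) (hg l).symm))

end LowerRows

/-! ### Restriction to labellings by the lower rows -/

section LowerCoeff

open MonoidAlgebra

variable {K : Type*} [Field K] {n p : ℕ} {μ : YoungDiagram} (T : Fin n ≃ μ.cells)
  (T' : Fin p ≃ μ.removeFirstRow.cells)

/-- The part of a tensor supported on the labellings `i₀ ∘ τ`, where `i₀` is the labelling of the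
positions by the labels below the first row and `τ` is a permutation. The labelling `i₀ ∘ τ` is
recorded as `τ⁻¹`, so that the permutation of positions becomes multiplication from the left. -/
noncomputable def lowerPart :
    tensorSpace K n p →ₗ[K] MonoidAlgebra K (Equiv.Perm (Fin p)) where
  toFun u := ∑ τ : Equiv.Perm (Fin p), single τ⁻¹ ((tensorBasis K n p).repr u (lowerLabel T T' ∘ τ))
  map_add' u v := by simp [Finset.sum_add_distrib, single_add]
  map_smul' c u := by simp [Finset.smul_sum]

theorem lowerPart_apply (u : tensorSpace K n p) : lowerPart T T' u =
    ∑ τ : Equiv.Perm (Fin p), single τ⁻¹ ((tensorBasis K n p).repr u (lowerLabel T T' ∘ τ)) := rfl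

theorem coeff_lowerPart (u : tensorSpace K n p) (τ : Equiv.Perm (Fin p)) :
    (lowerPart T T' u).coeff τ⁻¹ = (tensorBasis K n p).repr u (lowerLabel T T' ∘ τ) := by
  classical
  rw [lowerPart_apply, coeff_sum, Finsupp.finsetSum_apply, Finset.sum_eq_single τ]
  · simp
  · intro τ' _ h
    simp [h]
  · simp

theorem lowerPart_basis (τ : Equiv.Perm (Fin p)) :
    lowerPart (K := K) T T' (tensorBasis K n p (lowerLabel T T' ∘ τ)) = single τ⁻¹ 1 := by
  classical
  rw [lowerPart_apply, Finset.sum_eq_single τ]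
  · simp
  · intro τ' _ h
    have : lowerLabel T T' ∘ τ ≠ lowerLabel T T' ∘ τ' := fun h' =>
      h (Equiv.ext fun k => (lowerLabel_injective T T' (congrFun h' k)).symm)
    simp [this]
  · simp

theorem lowerPart_basis_eq_zero {i : Fin p → Fin n}
    (hi : ∀ τ : Equiv.Perm (Fin p), i ≠ lowerLabel T T' ∘ τ) :
    lowerPart (K := K) T T' (tensorBasis K n p i) = 0 := by
  classical
  rw [lowerPart_apply, Finset.sum_eq_zero]
  intro τ _
  simp [hi τ]

theorem lowerPart_tensorRep {g : Equiv.Perm (Fin n)} {ρ : Equiv.Perm (Fin p)}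
    (h : g ∘ lowerLabel T T' = lowerLabel T T' ∘ ρ) (u : tensorSpace K n p) :
    lowerPart T T' (tensorRep K n p g u) = lowerPart T T' u * single ρ⁻¹ 1 := by
  rw [lowerPart_apply, lowerPart_apply, Finset.sum_mul]
  refine (Fintype.sum_equiv (Equiv.mulLeft ρ) _ _ fun τ => ?_).symm
  have h1 : lowerLabel T T' ∘ ⇑(Equiv.mulLeft ρ τ) = g ∘ (lowerLabel T T' ∘ τ) := by
    rw [← Function.comp_assoc, h]
    rfl
  rw [h1, repr_tensorRep]
  simp

theorem repr_evalDiagram_ofPerm {r : ℕ} (σ : Equiv.Perm (Fin r)) (u : tensorSpace K n r)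
    (j : Fin r → Fin n) :
    (tensorBasis K n r).repr (evalDiagram K n (PartitionDiagram.ofPerm σ) u) j =
      (tensorBasis K n r).repr u (j ∘ σ) := by
  classical
  rw [repr_evalDiagram_apply, Finset.sum_eq_single (j ∘ σ)]
  · rw [PartitionDiagram.coeff, if_pos ((PartitionDiagram.compat_ofPerm σ _ _).2 rfl)]
    simp
  · intro i _ hi
    rw [PartitionDiagram.coeff, if_neg (mt (PartitionDiagram.compat_ofPerm σ _ _).1 hi)]
    simp
  · simp

theorem lowerPart_evalDiagram_ofPerm (σ : Equiv.Perm (Fin p)) (u : tensorSpace K n p) :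
    lowerPart T T' (evalDiagram K n (PartitionDiagram.ofPerm σ) u) =
      single σ 1 * lowerPart T T' u := by
  rw [lowerPart_apply, lowerPart_apply, Finset.mul_sum]
  refine Fintype.sum_equiv (Equiv.mulRight σ) _ _ fun τ => ?_
  rw [repr_evalDiagram_ofPerm]
  simp [Function.comp_assoc]

theorem rowSymmetrizer_apply {V : Type*} [AddCommMonoid V] [Module K V]
    (ρ : Representation K (Equiv.Perm (Fin n)) V) [DecidablePred (· ∈ rowSubgroup T)] (v : V) :
    ρ.asAlgebraHom (rowSymmetrizer K T) v = ∑ g with g ∈ rowSubgroup T, ρ g v := by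
  rw [rowSymmetrizer_eq, map_sum, LinearMap.sum_apply]
  simp

theorem colAntisymmetrizer_apply {V : Type*} [AddCommMonoid V] [Module K V]
    (ρ : Representation K (Equiv.Perm (Fin n)) V) [DecidablePred (· ∈ colSubgroup T)] (v : V) :
    ρ.asAlgebraHom (colAntisymmetrizer K T) v =
      ∑ g with g ∈ colSubgroup T, ((Equiv.Perm.sign g : ℤ) : K) • ρ g v := by
  rw [colAntisymmetrizer_eq, map_sum, LinearMap.sum_apply]
  simp

/-- Row permutations of `T` restrict to row permutations of `T'`, and each of the latter has the
same number of extensions. -/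
theorem lowerPart_rowSymmetrizer : ∃ c : ℕ, c ≠ 0 ∧ ∀ u : tensorSpace K n p,
    lowerPart T T' ((tensorRep K n p).asAlgebraHom (rowSymmetrizer K T) u) =
      (c : K) • (lowerPart T T' u * rowSymmetrizer K T') := by
  classical
  let S : Equiv.Perm (Fin p) → Finset (Equiv.Perm (Fin n)) := fun ρ =>
    {g | g ∈ rowSubgroup T ∧ g ∘ lowerLabel T T' = lowerLabel T T' ∘ ρ}
  -- multiplication by an extension of `ρ` identifies the extensions of `1` with those of `ρ`
  have hS : ∀ ρ ∈ rowSubgroup T', (S ρ).card = (S 1).card := fun ρ hρ => by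
    refine (Finset.card_equiv (Equiv.mulRight (extendLower T T' ρ)) fun g => ?_).symm
    have h1 := Subgroup.mul_mem_cancel_right (rowSubgroup T) (y := g)
      (extendLower_mem_rowSubgroup (T := T) hρ)
    have h2 : (g * extendLower T T' ρ) ∘ lowerLabel T T' = (g ∘ lowerLabel T T') ∘ ρ :=
      funext fun k => congrArg g (extendLower_lowerLabel T T' ρ k)
    simp only [S, Finset.mem_filter, Finset.mem_univ, true_and, Equiv.coe_mulRight, h1]
    rw [h2, ρ.surjective.injective_comp_right.eq_iff]
    rfl
  refine ⟨(S 1).card, ?_, fun u => ?_⟩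
  · exact Finset.card_ne_zero_of_mem (a := 1) (by simp [S, one_mem])
  have h1 : ∀ g ∈ rowSubgroup T, lowerPart T T' (tensorRep K n p g u) =
      ∑ ρ with ρ ∈ rowSubgroup T', if g ∘ lowerLabel T T' = lowerLabel T T' ∘ ρ then
        lowerPart T T' u * single ρ⁻¹ 1 else 0 := fun g hg => by
    obtain ⟨ρ, hρ, h⟩ := exists_comp_lowerLabel_of_mem_rowSubgroup (T' := T') hg
    rw [Finset.sum_eq_single ρ, if_pos h, lowerPart_tensorRep T T' h]
    · intro ρ' _ hne
      refine if_neg fun h' => hne (Equiv.ext fun k => lowerLabel_injective T T' ?_)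
      exact congrFun (h'.symm.trans h) k
    · intro hn
      exact absurd (by simpa using hρ) hn
  rw [rowSymmetrizer_apply, map_sum,
    Finset.sum_congr rfl fun g hg => h1 g (Finset.mem_filter.1 hg).2, Finset.sum_comm, ← reverse_rowSymmetrizer K T', rowSymmetrizer_eq, reverse_sum, Finset.mul_sum,
    Finset.smul_sum]
  refine Finset.sum_congr rfl fun ρ hρ => ?_
  rw [← Finset.sum_filter, Finset.filter_filter, Finset.sum_const,
    ← hS ρ (Finset.mem_filter.1 hρ).2, reverse_single, Nat.cast_smul_eq_nsmul]

/-- Only the column permutations that preserve the labels below the first row contribute, and these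
are the extensions of the column permutations of `T'`. -/
theorem lowerPart_colAntisymmetrizer_basis (τ : Equiv.Perm (Fin p)) :
    lowerPart T T' ((tensorRep K n p).asAlgebraHom (colAntisymmetrizer K T)
      (tensorBasis K n p (lowerLabel T T' ∘ τ))) = single τ⁻¹ 1 * colAntisymmetrizer K T' := by
  classical
  rw [colAntisymmetrizer_apply, map_sum, ← reverse_colAntisymmetrizer, colAntisymmetrizer_eq,
    reverse_sum, Finset.mul_sum]
  symm
  refine Finset.sum_of_injOn (extendLower T T') (extendLower_injective T T').injOn
    (fun ρ hρ => ?_) (fun g hg hne => ?_) fun ρ hρ => ?_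
  · simpa using extendLower_mem_colSubgroup (T := T) (by simpa using hρ)
  · rw [map_smul, tensorRep_basis, lowerPart_basis_eq_zero, smul_zero]
    intro τ' h
    have h1 : g ∘ lowerLabel T T' = lowerLabel T T' ∘ (τ' * τ⁻¹) := by
      funext k
      simpa using congrFun h (τ⁻¹ k)
    obtain ⟨h2, h3⟩ := exists_eq_extendLower (by simpa using hg) h1
    exact hne ⟨_, by simpa using h2, h3⟩
  · rw [map_smul, lowerPart_tensorRep T T' (ρ := ρ)
        (funext fun k => extendLower_lowerLabel T T' ρ k), lowerPart_basis, sign_extendLower]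
    simp

/-- A basis vector is either moved to a labelling by the lower rows by some column permutation,
which changes its image under the column antisymmetrizer at most by a sign, or that image has no part
supported on such labellings. -/
theorem exists_lowerPart_colAntisymmetrizer (u : tensorSpace K n p) :
    ∃ z, lowerPart T T' ((tensorRep K n p).asAlgebraHom (colAntisymmetrizer K T) u) =
      z * colAntisymmetrizer K T' := by
  classical
  suffices h : LinearMap.range (lowerPart T T' ∘ₗ
      (tensorRep K n p).asAlgebraHom (colAntisymmetrizer K T)) ≤
        LinearMap.range (LinearMap.mulRight K (colAntisymmetrizer K T')) by
    obtain ⟨z, hz⟩ := h ⟨u, rfl⟩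
    exact ⟨z, hz.symm⟩
  rw [LinearMap.range_eq_map, ← (tensorBasis K n p).span_eq, Submodule.map_span, Submodule.span_le]
  rintro _ ⟨_, ⟨i, rfl⟩, rfl⟩
  rw [SetLike.mem_coe, LinearMap.comp_apply]
  by_cases h : ∃ g ∈ colSubgroup T, ∃ τ : Equiv.Perm (Fin p), g ∘ i = lowerLabel T T' ∘ τ
  · obtain ⟨g, hg, τ, h⟩ := h
    have h1 : tensorBasis K n p i = (tensorRep K n p).asAlgebraHom (single g⁻¹ 1)
        (tensorBasis K n p (lowerLabel T T' ∘ τ)) := by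
      rw [Representation.asAlgebraHom_single_one, tensorRep_basis, ← h]
      congr 1
      funext k
      simp
    rw [h1, ← Module.End.mul_apply, ← map_mul, colAntisymmetrizer_mul_single K T (inv_mem hg),
      map_smul, LinearMap.smul_apply, map_smul, lowerPart_colAntisymmetrizer_basis]
    exact Submodule.smul_mem _ _ ⟨_, rfl⟩
  · push Not at h
    rw [colAntisymmetrizer_apply, map_sum, Finset.sum_eq_zero]
    · exact zero_mem _
    · intro g hg
      rw [map_smul, tensorRep_basis, lowerPart_basis_eq_zero, smul_zero]
      exact h g (Finset.mem_filter.1 hg).2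

end LowerCoeff

/-! ### Tensors killed by diagrams with few propagating blocks -/

namespace PartitionDiagram

variable {r s p n : ℕ}

/-- The propagating blocks of the kernel of `h` are distinguished by the values of `h` on them. -/
theorem pr_ker_le {X : Type*} (h : Fin r ⊕ Fin s → X) (S : Finset X)
    (hS : ∀ k m, h (Sum.inl k) = h (Sum.inr m) → h (Sum.inl k) ∈ S) :
    pr (Setoid.ker h) ≤ S.card := by
  rw [← Fintype.card_coe, ← Nat.card_eq_fintype_card]
  refine Nat.card_le_card_of_injective (fun q => ⟨Quotient.lift h (fun _ _ => id) q.1, ?_⟩) ?_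
  · obtain ⟨_, ⟨k, rfl⟩, m, hm⟩ := q
    exact hS k m (Quotient.exact hm).symm
  · rintro ⟨q, hq⟩ ⟨q', hq'⟩ hqq'
    induction q, q' using Quotient.inductionOn₂ with
    | h a b => exact Subtype.ext (Quotient.sound (congrArg Subtype.val hqq'))

/-- The identity diagram with the strand at `k` cut in two. -/
abbrev cut (k : Fin p) : PartitionDiagram p p :=
  Setoid.ker (Sum.elim (fun t => if t = k then Sum.inr false else Sum.inl t)
    fun t => if t = k then Sum.inr true else Sum.inl t : Fin p ⊕ Fin p → Fin p ⊕ Bool)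

/-- The identity diagram with the strands at `k` and `l` merged into one block. -/
abbrev merge (k l : Fin p) : PartitionDiagram p p :=
  Setoid.ker (Sum.elim (fun t => if t = l then k else t) fun t => if t = l then k else t)

theorem pr_cut_lt (k : Fin p) : pr (cut k) < p := by
  have hp : 0 < p := k.pos
  refine (pr_ker_le _ ((Finset.univ.erase k).map Function.Embedding.inl) ?_).trans_lt ?_
  · intro t m h
    by_cases ht : t = k <;> by_cases hm : m = k <;> simp_all
  · rw [Finset.card_map, Finset.card_erase_of_mem (Finset.mem_univ k), Finset.card_univ,
      Fintype.card_fin]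
    omega

theorem pr_merge_lt {k l : Fin p} (hkl : k ≠ l) : pr (merge k l) < p := by
  have hp : 0 < p := k.pos
  refine (pr_ker_le _ (Finset.univ.erase l) ?_).trans_lt ?_
  · intro t m h
    by_cases ht : t = l <;> simp_all
  · rw [Finset.card_erase_of_mem (Finset.mem_univ l), Finset.card_univ, Fintype.card_fin]
    omega

theorem compat_cut {k : Fin p} {i j : Fin p → Fin n} :
    Compat (cut k) i j ↔ i = Function.update j k (i k) := by
  constructor
  · intro h
    funext t
    rcases eq_or_ne t k with rfl | ht
    · simp
    · rw [Function.update_of_ne ht]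
      have h1 : (if t = k then (Sum.inr false : Fin p ⊕ Bool) else Sum.inl t) =
        if t = k then Sum.inr true else Sum.inl t := by rw [if_neg ht, if_neg ht]
      exact h (show cut k (Sum.inl t) (Sum.inr t) from h1)
  · intro h
    have h' : ∀ t, t ≠ k → i t = j t := fun t ht => by
      rw [h, Function.update_of_ne ht]
    clear h
    rintro (a | a) (b | b) hab <;> replace hab : _ = _ := hab <;>
      simp only [Sum.elim_inl, Sum.elim_inr] at hab <;>
      change _ = _ <;> simp only [Sum.elim_inl, Sum.elim_inr] <;>
      by_cases ha : a = k <;> by_cases hb : b = k <;> simp_all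

theorem compat_merge {k l : Fin p} {i j : Fin p → Fin n} :
    Compat (merge k l) i j ↔ i = j ∧ j k = j l := by
  constructor
  · intro h
    have hij : i = j := funext fun t => h (show merge k l (Sum.inl t) (Sum.inr t) from rfl)
    have h1 : (if k = l then k else k) = if l = l then k else l := by rw [if_pos rfl, ite_self]
    exact ⟨hij, h (show merge k l (Sum.inr k) (Sum.inr l) from h1)⟩
  · rintro ⟨rfl, h⟩
    have key : ∀ a b : Fin p, (if a = l then k else a) = (if b = l then k else b) → i a = i b := by
      intro a b hab
      by_cases ha : a = l <;> by_cases hb : b = l <;> simp_all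
    rintro (a | a) (b | b) hab <;> exact key a b hab

end PartitionDiagram

section Harmonic

open PartitionDiagram

variable {K : Type*} [Field K] {n p : ℕ}

theorem repr_evalDiagram_cut (k : Fin p) (u : tensorSpace K n p) (j : Fin p → Fin n) :
    (tensorBasis K n p).repr (evalDiagram K n (cut k) u) j =
      ∑ x, (tensorBasis K n p).repr u (Function.update j k x) := by
  classical
  rw [repr_evalDiagram_apply]
  symm
  refine Finset.sum_of_injOn (Function.update j k) (Function.update_injective j k).injOn
    (fun _ _ => by simp) (fun i _ hi => ?_) fun x _ => ?_
  · rw [PartitionDiagram.coeff, if_neg, Nat.cast_zero, mul_zero]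
    exact fun h => hi ⟨i k, by simp, (compat_cut.1 h).symm⟩
  · rw [PartitionDiagram.coeff, if_pos (compat_cut.2 (by simp)), Nat.cast_one, mul_one]

theorem repr_evalDiagram_merge {k l : Fin p} (u : tensorSpace K n p) {j : Fin p → Fin n}
    (hj : j k = j l) :
    (tensorBasis K n p).repr (evalDiagram K n (merge k l) u) j = (tensorBasis K n p).repr u j := by
  classical
  rw [repr_evalDiagram_apply, Finset.sum_eq_single j]
  · rw [PartitionDiagram.coeff, if_pos (compat_merge.2 ⟨rfl, hj⟩), Nat.cast_one, mul_one]
  · intro i _ hi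
    rw [PartitionDiagram.coeff, if_neg fun h => hi (compat_merge.1 h).1, Nat.cast_zero, mul_zero]
  · simp

variable [CharZero K] {μ : YoungDiagram} {T : Fin n ≃ μ.cells} {T' : Fin p ≃ μ.removeFirstRow.cells}

/-- A tensor that is fixed by the row permutations and killed by all diagrams with fewer than `p`
propagating blocks is determined by its coefficients at labellings by the lower rows. Summing over
all labels at a position that carries a label of the first row gives zero; by symmetry the labels of
the first row contribute a positive multiple of the given coefficient, and the other labels lead to
coefficients with fewer labels in the first row. -/
theorem eq_zero_of_lowerPart_eq_zero {u : tensorSpace K n p}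
    (hrow : ∀ g ∈ rowSubgroup T, tensorRep K n p g u = u)
    (hu : ∀ x : PartitionDiagram p p, x.pr < p → evalDiagram K n x u = 0)
    (h0 : lowerPart T T' u = 0) : u = 0 := by
  classical
  set c := (tensorBasis K n p).repr u with hc
  have hninj : ∀ i, ¬ Function.Injective i → c i = 0 := fun i hi => by
    simp only [Function.Injective] at hi
    push Not at hi
    obtain ⟨k, l, hkl, hne⟩ := hi
    rw [hc, ← repr_evalDiagram_merge u hkl, hu _ (pr_merge_lt hne)]
    simp
  have hsum : ∀ i k, ∑ x, c (Function.update i k x) = 0 := fun i k => by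
    rw [hc, ← repr_evalDiagram_cut, hu _ (pr_cut_lt k)]
    simp
  have hinv : ∀ g ∈ rowSubgroup T, ∀ i, c (g ∘ i) = c i := fun g hg i => by
    rw [hc, ← repr_tensorRep g u i, hrow g hg]
  suffices h : ∀ m i, (Finset.univ.filter fun k => (T (i k)).1.1 = 0).card = m → c i = 0 by
    rw [← (tensorBasis K n p).repr.map_eq_zero_iff, ← hc]
    exact Finsupp.ext fun i => h _ i rfl
  intro m
  induction m with
  | zero =>
    intro i hi
    by_cases hinj : Function.Injective i
    swap
    · exact hninj i hinj
    rw [Finset.card_eq_zero, Finset.filter_eq_empty_iff] at hi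
    have h1 : ∀ k, ∃ k', lowerLabel T T' k' = i k := fun k =>
      exists_lowerLabel_eq T T' (hi (Finset.mem_univ k))
    choose f hf using h1
    have hfinj : Function.Injective f := fun k l hkl => hinj (by rw [← hf, ← hf, hkl])
    have h2 := coeff_lowerPart T T' u (Equiv.ofBijective f (Finite.injective_iff_bijective.1 hfinj))
    have h3 : lowerLabel T T' ∘ f = i := funext hf
    rw [h0, Equiv.coe_ofBijective, h3] at h2
    exact h2.symm
  | succ m ih =>
    intro i hi
    by_cases hinj : Function.Injective i
    swap
    · exact hninj i hinj
    obtain ⟨k, hk⟩ := Finset.card_pos.1 (by rw [hi]; exact Nat.succ_pos m)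
    have hk0 : (T (i k)).1.1 = 0 := (Finset.mem_filter.1 hk).2
    -- the labels in the first row that can replace `i k` without destroying injectivity
    let S : Finset (Fin n) := {x | (T x).1.1 = 0 ∧ ∀ l, l ≠ k → i l ≠ x}
    have hterm : ∀ x, c (Function.update i k x) = if x ∈ S then c i else 0 := by
      intro x
      by_cases hx0 : (T x).1.1 = 0
      swap
      · -- `update i k x` has one label fewer in the first row
        rw [if_neg (by simp [S, hx0])]
        refine ih _ ?_
        have : (Finset.univ.filter fun t => (T (Function.update i k x t)).1.1 = 0) =
            (Finset.univ.filter fun t => (T (i t)).1.1 = 0).erase k := by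
          ext t
          rcases eq_or_ne t k with rfl | ht
          · simp [hx0]
          · simp [ht]
        rw [this, Finset.card_erase_of_mem hk, hi, Nat.add_sub_cancel]
      by_cases hx : ∀ l, l ≠ k → i l ≠ x
      swap
      · rw [if_neg (by simp only [S, Finset.mem_filter]; tauto)]
        push Not at hx
        obtain ⟨l, hl, rfl⟩ := hx
        exact hninj _ fun h => hl (h (by simp [hl]))
      · rw [if_pos (by simp only [S, Finset.mem_filter]; simp [hx0]; exact hx)]
        have h1 : Function.update i k x = Equiv.swap (i k) x ∘ i := by
          funext t
          rcases eq_or_ne t k with rfl | ht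
          · simp
          · rw [Function.update_of_ne ht, Function.comp_apply,
              Equiv.swap_apply_of_ne_of_ne (hinj.ne ht) (hx t ht)]
        rw [h1]
        refine hinv _ (fun l => ?_) i
        rcases eq_or_ne l (i k) with rfl | hl
        · rw [Equiv.swap_apply_left, hx0, hk0]
        rcases eq_or_ne l x with rfl | hl'
        · rw [Equiv.swap_apply_right, hx0, hk0]
        · rw [Equiv.swap_apply_of_ne_of_ne hl hl']
    have h1 := hsum i k
    rw [Finset.sum_congr rfl fun x _ => hterm x, ← Finset.sum_filter, Finset.sum_const,
      ← Nat.cast_smul_eq_nsmul K, smul_eq_zero] at h1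
    refine h1.resolve_left (Nat.cast_ne_zero.2 (Finset.card_ne_zero_of_mem (a := i k) ?_))
    simp only [S, Finset.mem_filter, Finset.mem_univ, true_and]
    exact ⟨hk0, fun l hl => hinj.ne hl⟩

end Harmonic

/-! ### The first nonzero multiplicity space -/

section Bottom

open MonoidAlgebra TensorHom

variable {K : Type*} [Field K] [CharZero K] {n p : ℕ} {μ : YoungDiagram} {T : Fin n ≃ μ.cells}

/-- The map `x ↦ x v` on the Specht module. -/
noncomputable def TensorHom.ofVector {r : ℕ} (T : Fin n ≃ μ.cells) (v : tensorSpace K n r) :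
    TensorHom (spechtRep K T) r :=
  show (spechtRep K T).IntertwiningMap (tensorRep K n r) from
  { toFun := fun x => (tensorRep K n r).asAlgebraHom x.1 v
    map_add' := fun x y => by simp
    map_smul' := fun c x => by simp
    isIntertwining' := fun g => LinearMap.ext fun x => by
      have h : (spechtRep K T g x).1 = single g 1 * x.1 := rfl
      simp [h] }

omit [CharZero K] in
theorem TensorHom.toLin_ofVector {r : ℕ} (v : tensorSpace K n r) (x : spechtModule K T) :
    toLin (ofVector T v) x = (tensorRep K n r).asAlgebraHom x.1 v := rfl

variable (T) (T' : Fin p ≃ μ.removeFirstRow.cells)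

/-- Evaluation at the Young symmetrizer, followed by restriction to labellings by the lower rows. -/
noncomputable def lowerEval (K : Type*) [Field K] (T : Fin n ≃ μ.cells)
    (T' : Fin p ≃ μ.removeFirstRow.cells) :
    TensorHom (spechtRep K T) p →ₗ[K] MonoidAlgebra K (Equiv.Perm (Fin p)) :=
  lowerPart T T' ∘ₗ LinearMap.applyₗ (spechtGen K T) ∘ₗ toLin

omit [CharZero K] in
theorem lowerEval_apply (f : TensorHom (spechtRep K T) p) :
    lowerEval K T T' f = lowerPart T T' (toLin f (spechtGen K T)) := rfl

theorem lowerEval_injective : Function.Injective (lowerEval K T T') := by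
  refine (injective_iff_map_eq_zero _).2 fun f hf => ext_spechtGen ?_
  rw [map_zero, LinearMap.zero_apply]
  refine eq_zero_of_lowerPart_eq_zero (T := T) (T' := T') (fun g hg => ?_) (fun x hx => ?_) hf
  · obtain ⟨v, hv⟩ := f.exists_toLin_spechtGen
    rw [hv, ← Representation.asAlgebraHom_single_one, ← Module.End.mul_apply, ← map_mul,
      single_mul_rowSymmetrizer K T hg]
  · rw [← toLin_act_of, act_of_eq_zero T (card_eq_add_rowLen T T') hx, map_zero,
      LinearMap.zero_apply]

theorem range_lowerEval : LinearMap.range (lowerEval K T T') = LinearMap.range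
    (LinearMap.mulRight K (colAntisymmetrizer K T' * rowSymmetrizer K T')) := by
  obtain ⟨c, hc, hrow⟩ := lowerPart_rowSymmetrizer (K := K) T T'
  have hc' : (c : K) ≠ 0 := Nat.cast_ne_zero.2 hc
  apply le_antisymm
  · rintro _ ⟨f, rfl⟩
    obtain ⟨v, hv⟩ := f.exists_toLin_spechtGen
    obtain ⟨z, hz⟩ := exists_lowerPart_colAntisymmetrizer T T' v
    rw [lowerEval_apply, hv, hrow, hz]
    exact ⟨(c : K) • z, by simp [mul_assoc]⟩
  · rintro _ ⟨z, rfl⟩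
    induction z using induction_linear with
    | zero => simp
    | add y z hy hz =>
      rw [map_add]
      exact add_mem hy hz
    | single σ a =>
      refine ⟨(a * (c : K)⁻¹) • ofVector T (tensorBasis K n p (lowerLabel T T' ∘ ⇑σ⁻¹)), ?_⟩
      rw [map_smul, lowerEval_apply, toLin_ofVector]
      change _ • lowerPart T T' ((tensorRep K n p).asAlgebraHom
        (rowSymmetrizer K T * colAntisymmetrizer K T) _) = _
      rw [map_mul, Module.End.mul_apply, hrow, lowerPart_colAntisymmetrizer_basis, inv_inv,
        smul_smul, inv_mul_cancel_right₀ hc', LinearMap.mulRight_apply, mul_assoc,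
        ← smul_mul_assoc, smul_single, smul_eq_mul, mul_one]

omit [CharZero K] in
theorem lowerEval_act_ofPerm (σ : Equiv.Perm (Fin p)) (f : TensorHom (spechtRep K T) p) :
    lowerEval K T T' (act (PartitionHom.of (PartitionDiagram.ofPerm σ)) f) =
      single σ 1 * lowerEval K T T' f := by
  rw [lowerEval_apply, toLin_act_of, lowerPart_evalDiagram_ofPerm, lowerEval_apply]

/-- Right multiplication by the row symmetrizer on the Specht module. -/
noncomputable def mulRowSymmetrizer (K : Type*) [Field K] (T : Fin n ≃ μ.cells) :
    spechtModule K T →ₗ[K] MonoidAlgebra K (Equiv.Perm (Fin n)) :=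
  LinearMap.mulRight K (rowSymmetrizer K T) ∘ₗ (spechtModule K T).subtype.restrictScalars K

omit [CharZero K] in
theorem mulRowSymmetrizer_apply (x : spechtModule K T) :
    mulRowSymmetrizer K T x = x.1 * rowSymmetrizer K T := rfl

theorem mulRowSymmetrizer_injective : Function.Injective (mulRowSymmetrizer K T) :=
  (injective_iff_map_eq_zero _).2 fun x hx => Subtype.ext (eq_zero_of_mul_rowSymmetrizer x.2 hx)

theorem range_mulRowSymmetrizer : LinearMap.range (mulRowSymmetrizer K T) = LinearMap.range
    (LinearMap.mulRight K (colAntisymmetrizer K T * rowSymmetrizer K T)) := by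
  apply le_antisymm
  · rintro _ ⟨x, rfl⟩
    obtain ⟨y, hy⟩ := mem_spechtModule.1 x.2
    exact ⟨y * rowSymmetrizer K T, by simp [mulRowSymmetrizer_apply, ← hy, mul_assoc]⟩
  · rintro _ ⟨z, rfl⟩
    obtain ⟨y, hy⟩ := exists_mul_row_col_row K T
    refine ⟨(z * y) • spechtGen K T, ?_⟩
    rw [LinearMap.mulRight_apply, ← hy]
    simp [mulRowSymmetrizer_apply, spechtGen, mul_assoc]

/-- The Specht module of the lower rows is isomorphic to the multiplicity space of `S^μ` in the
`p`-th tensor power: both are identified with the left ideal of the group algebra of `𝔖_p`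
generated by the product of the column antisymmetrizer and the row symmetrizer. -/
noncomputable def bottomEquiv : spechtModule K T' ≃ₗ[K] TensorHom (spechtRep K T) p :=
  (LinearEquiv.ofInjective _ (mulRowSymmetrizer_injective T')).trans <|
    (LinearEquiv.ofEq _ _ ((range_mulRowSymmetrizer T').trans (range_lowerEval T T').symm)).trans
      (LinearEquiv.ofInjective _ (lowerEval_injective T T')).symm

theorem lowerEval_bottomEquiv (w : spechtModule K T') :
    lowerEval K T T' (bottomEquiv T T' w) = w.1 * rowSymmetrizer K T' := by
  rw [← LinearEquiv.ofInjective_apply (h := lowerEval_injective T T'), bottomEquiv,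
    LinearEquiv.trans_apply, LinearEquiv.trans_apply, LinearEquiv.apply_symm_apply]
  rfl

theorem bottomEquiv_spechtRep (σ : Equiv.Perm (Fin p)) (w : spechtModule K T') :
    bottomEquiv T T' (spechtRep K T' σ w) =
      act (PartitionHom.of (PartitionDiagram.ofPerm σ)) (bottomEquiv T T' w) := by
  refine lowerEval_injective T T' ?_
  rw [lowerEval_act_ofPerm, lowerEval_bottomEquiv, lowerEval_bottomEquiv, ← mul_assoc]
  rfl

end Bottom

/-! ### The Specht module as a direct summand of a tensor power -/

section Splitting

open MonoidAlgebra TensorHom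

variable {K : Type*} [Field K] {n p : ℕ} {μ : YoungDiagram} (T : Fin n ≃ μ.cells)
  (T' : Fin p ≃ μ.removeFirstRow.cells)

open Classical in
/-- The equivariant map from the tensor power to the group algebra that sends `v_i` to the sum of
the permutations that carry the labelling of the positions by the lower rows to `i`. -/
noncomputable def lowerOrbit (K : Type*) [Field K] (T : Fin n ≃ μ.cells)
    (T' : Fin p ≃ μ.removeFirstRow.cells) :
    tensorSpace K n p →ₗ[K] MonoidAlgebra K (Equiv.Perm (Fin n)) :=
  (tensorBasis K n p).constr K fun i =>
    ∑ h : Equiv.Perm (Fin n) with ∀ k, h (lowerLabel T T' k) = i k, single h 1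

open Classical in
theorem lowerOrbit_basis (i : Fin p → Fin n) : lowerOrbit K T T' (tensorBasis K n p i) =
    ∑ h : Equiv.Perm (Fin n) with ∀ k, h (lowerLabel T T' k) = i k, single h 1 := by
  simp [lowerOrbit]

theorem lowerOrbit_tensorRep (g : Equiv.Perm (Fin n)) (v : tensorSpace K n p) :
    lowerOrbit K T T' (tensorRep K n p g v) = single g 1 * lowerOrbit K T T' v := by
  classical
  suffices h : lowerOrbit K T T' ∘ₗ tensorRep K n p g =
      LinearMap.mulLeft K (single g 1) ∘ₗ lowerOrbit K T T' from LinearMap.congr_fun h v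
  refine (tensorBasis K n p).ext fun i => ?_
  rw [LinearMap.comp_apply, LinearMap.comp_apply, tensorRep_basis, lowerOrbit_basis,
    lowerOrbit_basis, LinearMap.mulLeft_apply, Finset.mul_sum]
  symm
  refine Finset.sum_equiv (Equiv.mulLeft g) (fun h => ?_) fun h _ => by simp
  simp

theorem lowerOrbit_asAlgebraHom (y : MonoidAlgebra K (Equiv.Perm (Fin n)))
    (v : tensorSpace K n p) :
    lowerOrbit K T T' ((tensorRep K n p).asAlgebraHom y v) = y * lowerOrbit K T T' v := by
  induction y using induction_linear with
  | zero => simp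
  | add y z hy hz => simp [hy, hz, add_mul]
  | single g c =>
    have h : (single g c : MonoidAlgebra K (Equiv.Perm (Fin n))) = c • single g 1 := by simp
    rw [h, map_smul, LinearMap.smul_apply, map_smul, Representation.asAlgebraHom_single_one,
      lowerOrbit_tensorRep, smul_mul_assoc]

/-- A permutation that fixes all labels below the first row preserves the rows. -/
theorem exists_rowSymmetrizer_mul_lowerOrbit : ∃ c : ℕ, c ≠ 0 ∧
    rowSymmetrizer K T * lowerOrbit K T T' (tensorBasis K n p (lowerLabel T T')) =
      (c : K) • rowSymmetrizer K T := by
  classical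
  refine ⟨Finset.card {h : Equiv.Perm (Fin n) | ∀ k, h (lowerLabel T T' k) = lowerLabel T T' k},
    Finset.card_ne_zero_of_mem (a := 1) (by simp), ?_⟩
  rw [lowerOrbit_basis, Finset.mul_sum, Nat.cast_smul_eq_nsmul, ← Finset.sum_const]
  refine Finset.sum_congr rfl fun h hh => rowSymmetrizer_mul_single K T ?_
  have hh' : ∀ k, h (lowerLabel T T' k) = lowerLabel T T' k :=
    (Finset.mem_filter.1 hh).2
  refine forall_label T T' (fun k => by rw [hh']) fun l hl => ?_
  rw [hl]
  by_contra hne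
  obtain ⟨k, hk⟩ := exists_lowerLabel_eq T T' hne
  have h1 : l = lowerLabel T T' k := h.injective (by rw [hh', hk])
  rw [h1, fst_lowerLabel] at hl
  omega

/-- The Specht module `S^μ` is a direct summand of the `p`-th tensor power of `V`. -/
theorem exists_splitting [CharZero K] (T' : Fin p ≃ μ.removeFirstRow.cells) :
    ∃ (g : TensorHom (spechtRep K T) p) (π : tensorSpace K n p →ₗ[K] spechtModule K T),
      (∀ σ v, π (tensorRep K n p σ v) = spechtRep K T σ (π v)) ∧ ∀ x, π (toLin g x) = x := by
  obtain ⟨u, hu⟩ := exists_spechtModule_rightUnit K T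
  obtain ⟨y, hy⟩ := exists_row_col_row_mul K T
  obtain ⟨c, hc, hcc⟩ := exists_rowSymmetrizer_mul_lowerOrbit (K := K) T T'
  have hc' : (c : K) ≠ 0 := Nat.cast_ne_zero.2 hc
  -- `y` undoes the right multiplication by the row symmetrizer, and the right unit `u` brings the
  -- result back into the Specht module
  let π : tensorSpace K n p →ₗ[K] spechtModule K T := (c : K)⁻¹ •
    ((LinearMap.toSpanSingleton (MonoidAlgebra K (Equiv.Perm (Fin n))) _ u).restrictScalars K ∘ₗ
      LinearMap.mulRight K y ∘ₗ lowerOrbit K T T')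
  have hπ : ∀ v, π v = (c : K)⁻¹ • (lowerOrbit K T T' v * y) • u := fun v => rfl
  refine ⟨ofVector T ((tensorRep K n p).asAlgebraHom (rowSymmetrizer K T)
    (tensorBasis K n p (lowerLabel T T'))), π, fun σ v => ?_, fun x => ?_⟩
  · rw [hπ, hπ, lowerOrbit_tensorRep, spechtRep_apply, mul_assoc, mul_smul,
      smul_comm (c : K)⁻¹]
  · obtain ⟨z, hz⟩ := mem_spechtModule.1 x.2
    have h1 : x.1 * (rowSymmetrizer K T * y) = x.1 := by
      rw [← hz, ← mul_assoc, mul_assoc z, mul_assoc z, hy]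
    rw [hπ, toLin_ofVector, lowerOrbit_asAlgebraHom, lowerOrbit_asAlgebraHom, hcc, mul_smul_comm,
      smul_mul_assoc, mul_assoc, h1, smul_assoc, hu, inv_smul_smul₀ hc']

end Splitting

/-! ### Maps out of the inflation -/

/-- If all `p` upper and all `p` lower vertices are needed to get `p` propagating blocks, then each
block is a pair of an upper and a lower vertex. -/
theorem PartitionDiagram.exists_eq_ofPerm {p : ℕ} {x : PartitionDiagram p p} (hx : x.pr = p) :
    ∃ σ, x = ofPerm σ := by
  let P := {q : Quotient x // (∃ i, Quotient.mk x (Sum.inl i) = q) ∧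
    ∃ j, Quotient.mk x (Sum.inr j) = q}
  have hP : Nat.card P = Nat.card (Fin p) := by
    rw [Nat.card_eq_fintype_card (α := Fin p), Fintype.card_fin]
    exact hx
  have ht : Function.Surjective fun q : P => q.2.1.choose := by
    refine (Function.Injective.bijective_of_nat_card_le (fun q q' h => Subtype.ext ?_) hP.ge).2
    exact q.2.1.choose_spec.symm.trans ((congrArg (fun i => Quotient.mk x (Sum.inl i)) h).trans
      q'.2.1.choose_spec)
  have hb : Function.Surjective fun q : P => q.2.2.choose := by
    refine (Function.Injective.bijective_of_nat_card_le (fun q q' h => Subtype.ext ?_) hP.ge).2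
    exact q.2.2.choose_spec.symm.trans ((congrArg (fun i => Quotient.mk x (Sum.inr i)) h).trans
      q'.2.2.choose_spec)
  have h1 : ∀ i, ∃ j, x (Sum.inl i) (Sum.inr j) := fun i => by
    obtain ⟨q, rfl⟩ := ht i
    exact q.2.2.imp fun j hj => Quotient.exact (q.2.1.choose_spec.trans hj.symm)
  have h2 : ∀ i i', x (Sum.inl i) (Sum.inl i') → i = i' := fun i i' h => by
    obtain ⟨q, rfl⟩ := ht i
    obtain ⟨q', rfl⟩ := ht i'
    have : q = q' := Subtype.ext
      (q.2.1.choose_spec.symm.trans ((Quotient.sound h).trans q'.2.1.choose_spec))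
    rw [this]
  have h3 : ∀ j j', x (Sum.inr j) (Sum.inr j') → j = j' := fun j j' h => by
    obtain ⟨q, rfl⟩ := hb j
    obtain ⟨q', rfl⟩ := hb j'
    have : q = q' := Subtype.ext
      (q.2.2.choose_spec.symm.trans ((Quotient.sound h).trans q'.2.2.choose_spec))
    rw [this]
  choose f hf using h1
  have hinj : Function.Injective f := fun i i' h => h2 i i' <|
    x.trans (hf i) (by rw [h]; exact x.symm (hf i'))
  let σ : Equiv.Perm (Fin p) := Equiv.ofBijective f (Finite.injective_iff_bijective.1 hinj)
  have hσ : ∀ a, x a (Sum.inr (Sum.elim σ id a)) := by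
    rintro (i | j)
    · exact hf i
    · exact x.refl _
  refine ⟨σ, Setoid.ext fun a b => ⟨fun h => ?_, fun h => ?_⟩⟩
  · exact h3 _ _ (x.trans (x.symm (hσ a)) (x.trans h (hσ b)))
  · have h' : Sum.elim σ id a = Sum.elim σ id b := h
    exact x.trans (hσ a) (by rw [h']; exact x.symm (hσ b))

section Induced

open TensorHom PropagatingHom

variable {K : Type*} [Field K] {n p r s : ℕ} {U : Type*} [AddCommGroup U] [Module K U]
  {ρ : Representation K (Equiv.Perm (Fin n)) U} {W : Type*} [AddCommGroup W] [Module K W]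
  {ρ' : Representation K (Equiv.Perm (Fin p)) W}

theorem TensorHom.act_incl_proj {f : TensorHom ρ p}
    (hf : ∀ {s : ℕ} (x : PartitionDiagram p s), x.pr < p → act (PartitionHom.of x) f = 0)
    (z : PartitionHom K (n : K) p r) : act (incl (proj z)) f = act z f := by
  have h : act.flip f ∘ₗ incl ∘ₗ proj =
      (act.flip f : PartitionHom K (n : K) p r →ₗ[K] TensorHom ρ r) := by
    refine PartitionHom.hom_ext fun x => ?_
    rw [LinearMap.comp_apply, LinearMap.comp_apply, incl_proj_of]
    split_ifs with hx
    · rfl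
    · rw [map_zero]
      exact (hf x (lt_of_le_of_ne x.pr_le_left hx)).symm
  exact LinearMap.congr_fun h z

/-- A map of `𝔖_p`-modules `θ` from `W` to `Hom_{𝔖_n}(U, ⊗^p V)` whose image is killed by the
diagrams with fewer than `p` propagating blocks induces maps `Inf_p^r W → Hom_{𝔖_n}(U, ⊗^r V)`. -/
noncomputable def inflationLift (θ : W →ₗ[K] TensorHom ρ p)
    (hθ : ∀ σ w, θ (ρ' σ w) = act (PartitionHom.of (PartitionDiagram.ofPerm σ)) (θ w))
    (hkill : ∀ {s : ℕ} (x : PartitionDiagram p s) w, x.pr < p →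
      act (PartitionHom.of x) (θ w) = 0) (r : ℕ) :
    Inflation (n : K) ρ' r →ₗ[K] TensorHom ρ r :=
  Submodule.liftQ (inflationRelations (n : K) ρ' r)
    (TensorProduct.lift ((act ∘ₗ incl).flip ∘ₗ θ)) <| Submodule.span_le.2 <| by
      rintro _ ⟨σ, w, m, rfl⟩
      rw [SetLike.mem_coe, LinearMap.mem_ker, map_sub, sub_eq_zero, TensorProduct.lift.tmul,
        TensorProduct.lift.tmul]
      change act (incl m) (θ (ρ' σ w)) = act (incl (permLeft σ m)) (θ w)
      rw [hθ, permLeft, LinearMap.comp_apply, LinearMap.comp_apply,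
        act_incl_proj fun x hx => hkill x w hx, act_mul]

variable {θ : W →ₗ[K] TensorHom ρ p}
  {hθ : ∀ σ w, θ (ρ' σ w) = act (PartitionHom.of (PartitionDiagram.ofPerm σ)) (θ w)}
  {hkill : ∀ {s : ℕ} (x : PartitionDiagram p s) w, x.pr < p → act (PartitionHom.of x) (θ w) = 0}

theorem inflationLift_tmul (w : W) (m : PropagatingHom K (n : K) p r) :
    inflationLift θ hθ hkill r (Inflation.tmul w m) = TensorHom.act (incl m) (θ w) := rfl

theorem inflationLift_act (x : PartitionHom K (n : K) r s) (v : Inflation (n : K) ρ' r) :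
    inflationLift θ hθ hkill s (Inflation.act x v) =
      TensorHom.act x (inflationLift θ hθ hkill r v) := by
  have h : inflationLift θ hθ hkill s ∘ₗ Inflation.act x =
      TensorHom.act x ∘ₗ inflationLift θ hθ hkill r := by
    refine Inflation.hom_ext fun w m => ?_
    rw [LinearMap.comp_apply, LinearMap.comp_apply, Inflation.act_tmul, inflationLift_tmul,
      inflationLift_tmul, mulRight, LinearMap.compr₂_apply, LinearMap.comp_apply,
      act_incl_proj fun x hx => hkill x w hx, TensorHom.act_mul]
  exact LinearMap.congr_fun h v

/-- In `Inf_p^r W` a morphism `y : p → p` can be moved across the tensor product: modulo diagrams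
with fewer than `p` propagating blocks it is a combination of permutation diagrams. -/
theorem tmul_proj_mul_incl (θ : W ≃ₗ[K] TensorHom ρ p)
    (hθ : ∀ σ w, θ (ρ' σ w) = act (PartitionHom.of (PartitionDiagram.ofPerm σ)) (θ w))
    (hkill : ∀ {s : ℕ} (x : PartitionDiagram p s) w, x.pr < p → act (PartitionHom.of x) (θ w) = 0)
    (w : W) (y : PartitionHom K (n : K) p p) (m : PropagatingHom K (n : K) p r) :
    (Inflation.tmul w (proj (PartitionHom.mul y (incl m))) : Inflation (n : K) ρ' r) =
      Inflation.tmul (θ.symm (act y (θ w))) m := by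
  let A : PartitionHom K (n : K) p p →ₗ[K] Inflation (n : K) ρ' r :=
    (inflationRelations (n : K) ρ' r).mkQ ∘ₗ TensorProduct.mk K W _ w ∘ₗ proj ∘ₗ
      PartitionHom.mul.flip (incl m)
  let B : PartitionHom K (n : K) p p →ₗ[K] Inflation (n : K) ρ' r :=
    (inflationRelations (n : K) ρ' r).mkQ ∘ₗ (TensorProduct.mk K W _).flip m ∘ₗ
      θ.symm.toLinearMap ∘ₗ act.flip (θ w)
  have h : A = B := by
    refine PartitionHom.hom_ext fun x => ?_
    change Inflation.tmul w (proj (PartitionHom.mul (PartitionHom.of x) (incl m))) =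
      Inflation.tmul (θ.symm (act (PartitionHom.of x) (θ w))) m
    by_cases hx : x.pr = p
    · obtain ⟨σ, rfl⟩ := PartitionDiagram.exists_eq_ofPerm hx
      rw [← hθ, θ.symm_apply_apply]
      have hmem : ρ' σ w ⊗ₜ[K] m - w ⊗ₜ[K] permLeft σ m ∈ inflationRelations (n : K) ρ' r :=
        Submodule.subset_span ⟨σ, w, m, rfl⟩
      exact ((Submodule.Quotient.eq _).2 hmem).symm
    · have hlt : x.pr < p := lt_of_le_of_ne x.pr_le_left hx
      have h0 : proj (PartitionHom.mul (PartitionHom.of x) (incl m)) = 0 := by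
        have h1 : proj ∘ₗ PartitionHom.mul (PartitionHom.of x) ∘ₗ incl =
            (0 : PropagatingHom K (n : K) p r →ₗ[K] _) := by
          refine PropagatingHom.hom_ext fun y hy => ?_
          simp only [LinearMap.comp_apply, incl_of, PartitionHom.mul_of, map_smul]
          rw [proj_of_ne ((x.pr_comp_le_left y).trans_lt hlt).ne, smul_zero, LinearMap.zero_apply]
        exact LinearMap.congr_fun h1 m
      rw [h0, hkill x w hlt, map_zero]
      change (inflationRelations (n : K) ρ' r).mkQ (w ⊗ₜ 0) =
        (inflationRelations (n : K) ρ' r).mkQ (0 ⊗ₜ m)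
      rw [TensorProduct.tmul_zero, TensorProduct.zero_tmul]
  exact LinearMap.congr_fun h y

/-- If `U` is a direct summand of the `p`-th tensor power, then the map from the inflation of
`Hom_{𝔖_n}(U, ⊗^p V)` to `Hom_{𝔖_n}(U, ⊗^r V)` is bijective: extending maps from `U` to the tensor
power along a projection turns them into morphisms `p → r` of the partition category, and these
are determined by their evaluations since `p + r ≤ n`. -/
theorem inflationLift_bijective (θ : W ≃ₗ[K] TensorHom ρ p)
    (hθ : ∀ σ w, θ (ρ' σ w) = act (PartitionHom.of (PartitionDiagram.ofPerm σ)) (θ w))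
    (hkill : ∀ {s : ℕ} (x : PartitionDiagram p s) w, x.pr < p → act (PartitionHom.of x) (θ w) = 0)
    (hpp : p + p ≤ n) (hpr : p + r ≤ n) (g : TensorHom ρ p) (π : tensorSpace K n p →ₗ[K] U)
    (hπ : ∀ σ v, π (tensorRep K n p σ v) = ρ σ (π v)) (hg : ∀ u, π (toLin g u) = u) :
    Function.Bijective (inflationLift θ.toLinearMap hθ hkill r) := by
  have hext : ∀ {s : ℕ}, p + s ≤ n → ∀ f : TensorHom ρ s,
      ∃ x : PartitionHom K (n : K) p s, evalHom x = toLin f ∘ₗ π := fun hs f =>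
    exists_evalHom_eq hs _ fun σ v => by
      rw [LinearMap.comp_apply, hπ, toLin_rho, LinearMap.comp_apply]
  have hact : ∀ {s : ℕ} {f : TensorHom ρ s} {x : PartitionHom K (n : K) p s},
      evalHom x = toLin f ∘ₗ π → act x g = f := fun {s f x} hx => toLin_injective <| by
    rw [toLin_act, hx]
    exact LinearMap.ext fun u => congrArg (toLin f) (hg u)
  have hlift : ∀ m : PropagatingHom K (n : K) p r, inflationLift θ.toLinearMap hθ hkill r
      (Inflation.tmul (θ.symm g) m) = act (incl m) g := fun m => by
    rw [inflationLift_tmul, LinearEquiv.coe_coe, θ.apply_symm_apply]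
  have htmul : ∀ y : PartitionHom K (n : K) p p, ∀ m : PropagatingHom K (n : K) p r,
      (Inflation.tmul (θ.symm g) (proj (PartitionHom.mul y (incl m))) : Inflation (n : K) ρ' r) =
        Inflation.tmul (θ.symm (act y g)) m := fun y m => by
    rw [tmul_proj_mul_incl θ hθ hkill, θ.apply_symm_apply]
  constructor
  · have hsurj : ∀ v : Inflation (n : K) ρ' r, ∃ m, v = Inflation.tmul (θ.symm g) m := by
      intro v
      obtain ⟨t, rfl⟩ := Submodule.Quotient.mk_surjective _ v
      induction t using TensorProduct.induction_on with
      | zero =>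
        exact ⟨0, congrArg (inflationRelations (n : K) ρ' r).mkQ (TensorProduct.tmul_zero _ _).symm⟩
      | tmul w m =>
        obtain ⟨y, hy⟩ := hext hpp (θ w)
        refine ⟨proj (PartitionHom.mul y (incl m)), ?_⟩
        rw [htmul, hact hy, θ.symm_apply_apply]
        rfl
      | add t t' ht ht' =>
        obtain ⟨m, hm⟩ := ht
        obtain ⟨m', hm'⟩ := ht'
        refine ⟨m + m', ?_⟩
        rw [Inflation.tmul_add, ← hm, ← hm']
        rfl
    refine (injective_iff_map_eq_zero _).2 fun v hv => ?_
    obtain ⟨m, rfl⟩ := hsurj v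
    obtain ⟨y, hy⟩ := hext hpp g
    rw [hlift] at hv
    have h0 : PartitionHom.mul y (incl m) = 0 := evalHom_injective hpr <| by
      rw [evalHom_mul, hy, ← LinearMap.comp_assoc, ← toLin_act, hv, map_zero, map_zero,
        LinearMap.zero_comp]
    have h1 := htmul y m
    rw [hact hy, h0, map_zero] at h1
    rw [← h1]
    exact congrArg (inflationRelations (n : K) ρ' r).mkQ (TensorProduct.tmul_zero _ _)
  · intro f
    obtain ⟨x, hx⟩ := hext hpr f
    refine ⟨Inflation.tmul (θ.symm g) (proj x), ?_⟩
    rw [hlift, act_incl_proj, hact hx]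
    intro s y hy
    simpa using hkill y (θ.symm g) hy

theorem Inflation.eq_zero_of_lt {δ : K} (hr : r < p) (v : Inflation δ ρ' r) : v = 0 := by
  have : IsEmpty {x : PartitionDiagram p r // x.pr = p} :=
    ⟨fun x => absurd x.1.pr_le_right (by rw [x.2]; omega)⟩
  have h : (LinearMap.id : Inflation δ ρ' r →ₗ[K] _) = 0 := Inflation.hom_ext fun w m => by
    have hm : m = 0 := Subsingleton.elim (α := {x : PartitionDiagram p r // x.pr = p} →₀ K) _ _
    rw [hm]
    exact congrArg (inflationRelations δ ρ' r).mkQ (TensorProduct.tmul_zero _ _)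
  exact LinearMap.congr_fun h v

end Induced

/-! ### The isomorphism -/

theorem mainTheorem12 (K : Type*) [Field K] [CharZero K] (n : ℕ) (μ : YoungDiagram)
    (T : Fin n ≃ μ.cells) (p : ℕ) (T' : Fin p ≃ μ.removeFirstRow.cells) :
    ∃ φ : ∀ r : ℕ, 2 * r ≤ n →
        (TensorHom (spechtRep K T) r ≃ₗ[(PartitionAlgebra K (n : K) r)ᵐᵒᵖ]
          Inflation (n : K) (spechtRep K T') r),
      ∀ (r s : ℕ) (hr : 2 * r ≤ n) (hs : 2 * s ≤ n) (x : PartitionHom K (n : K) r s)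
        (f : TensorHom (spechtRep K T) r),
        φ s hs (TensorHom.act x f) = Inflation.act x (φ r hr f) := by
  have hn := card_eq_add_rowLen T T'
  have hkill : ∀ {s : ℕ} (x : PartitionDiagram p s) (w : spechtModule K T'), x.pr < p →
      TensorHom.act (PartitionHom.of x) (bottomEquiv T T' w) = 0 := fun x w hx =>
    TensorHom.act_of_eq_zero T hn hx _
  let Ψ := inflationLift (bottomEquiv (K := K) T T').toLinearMap (bottomEquiv_spechtRep T T') hkill
  have hΨ : ∀ r, 2 * r ≤ n → Function.Bijective (Ψ r) := by
    intro r hr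
    by_cases hp : p + p ≤ n
    · obtain ⟨g, π, hπ, hg⟩ := exists_splitting (K := K) T T'
      exact inflationLift_bijective (bottomEquiv T T') (bottomEquiv_spechtRep T T') hkill hp
        (by omega) g π hπ hg
    · -- here `r < p`, and both modules vanish
      have hrp : r < p := by omega
      exact ⟨fun v w _ => (Inflation.eq_zero_of_lt hrp v).trans
          (Inflation.eq_zero_of_lt hrp w).symm,
        fun f => ⟨0, (map_zero _).trans (TensorHom.eq_zero_of_lt T hn hrp f).symm⟩⟩
  let e : ∀ r, 2 * r ≤ n → Inflation (n : K) (spechtRep K T') r ≃ₗ[K] TensorHom (spechtRep K T) r :=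
    fun r hr => LinearEquiv.ofBijective (Ψ r) (hΨ r hr)
  have hact : ∀ (r s : ℕ) (hr : 2 * r ≤ n) (hs : 2 * s ≤ n) (x : PartitionHom K (n : K) r s)
      (f : TensorHom (spechtRep K T) r),
      (e s hs).symm (TensorHom.act x f) = Inflation.act x ((e r hr).symm f) := by
    intro r s hr hs x f
    rw [LinearEquiv.symm_apply_eq]
    refine Eq.trans ?_ (inflationLift_act (hθ := bottomEquiv_spechtRep T T')
      (hkill := hkill) x _).symm
    exact congrArg (TensorHom.act x) ((e r hr).apply_symm_apply f).symm
  refine ⟨fun r hr =>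
    { toFun := (e r hr).symm
      invFun := e r hr
      map_add' := map_add _
      map_smul' := fun x f => hact r r hr hr x.unop f
      left_inv := (e r hr).apply_symm_apply
      right_inv := (e r hr).symm_apply_apply }, hact⟩
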